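/- Let $r\in[1,\infty]$ and let $s\in[1,\infty]$ be its dual exponent, $\frac1r+\frac1s=1$ (so $s=\frac r{r-1}$). Let $v\in L^{2r}(\mathbb R^3)$ be a real-valued interaction potential with $v(-x)=v(x)$ for almost every $x$, and for each time $t$ let $A^t:\mathbb R^3\to\mathbb R$ be a measurable external potential. Let $N\ge1$ and $T\ge 0$. Let $\Psi_N^t\in L^2(\mathbb R^{3N})$, $t\in[0,T]$, be a solution of the $N$-body Schrödinger equation in the mean-field scaling $v_N=N^{-1}v$, $$i\partial_t\Psi_N^t=H_N^t\Psi_N^t,\qquad H_N^t=-\sum_{j=1}^N\Delta_j+\sum_{1\le j<k\le N}N^{-1}v(x_j-x_k)+\sum_{j=1}^NA^t(x_j),$$ whose initial value $\Psi_N^0$ is symmetric under permutations of the particles and has $\|\Psi_N^0\|_2=1$. Let $\varphi^t\in L^2(\mathbb R^3)$, $t\in[0,T]$, be a solution of the Hartree equation $$i\partial_t\varphi^t=\big(-\Delta+A^t+v\star|\varphi^t|^2\big)\varphi^t$$ with $\|\varphi^0\|_2=1$ and $\|\varphi^t\|_{2s}<\infty$ for all $t\in[0,T]$. Here a solution of $i\partial_tf^t=(-\Delta+V^t)f^t$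 is a strong one: for every $t\in[0,T]$ the distributional Laplacian $\Delta f^t$ and the product $V^tf^t$ are in $L^2$, the curve $f$ is differentiable in $L^2$ at $t$ (one-sidedly at the end points), and the equation holds in $L^2$ at $t$; for the first equation $\Delta=\sum_j\Delta_j$ and $V^t$ is the whole potential of $H_N^t$, for the second $V^t=A^t+v\star|\varphi^t|^2$. For $\varphi\in L^2(\mathbb R^3)$ let $p_j^\varphi=|\varphi(x_j)\rangle\langle\varphi(x_j)|$ on $L^2(\mathbb R^{3N})$, i.e. $(p_j^\varphi\Psi)(x_1,\dots,x_N)=\varphi(x_j)\int\overline{\varphi(x_j)}\,\Psi(x_1,\dots,x_N)\,dx_j$, let $q_j^\varphi=1-p_j^\varphi$, and $$P_{N,k}^\varphi=\sum_{a\in\{0,1\}^N,\ \sum_ja_j=k}\ \prod_{j=1}^N(p_j^\varphi)^{1-a_j}(q_j^\varphi)^{a_j},\qquad \alpha_N(\Psi,\varphi)=\Big\langle\Psi,\sum_{k=0}^N\tfrac kN\,P_{N,k}^\varphi\Psi\Big\rangle .$$ Put $C^t=10\,\|v\|_{2r}\|\varphi^t\|_{2s}$, and assume that $t\mapsto C^t$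 is integrable on $[0,T]$. Then for all $t\in[0,T]$ $$\alpha_N(\Psi_N^t,\varphi^t)\le e^{\int_0^tC^\tau d\tau}\,\alpha_N(\Psi_N^0,\varphi^0)+\Big(e^{\int_0^tC^\tau d\tau}-1\Big)N^{-1},$$ and $\alpha_N(\Psi_N^t,\varphi^t)=\|q_j^{\varphi^t}\Psi_N^t\|_2^2$ for every $j\in\{1,\dots,N\}$ (in particular for $j=1$). -/

import Mathlib

open MeasureTheory Function
open scoped ENNReal ComplexConjugate ContDiff Convolution Laplacian

noncomputable section

namespace MeanField

/-- One-particle configuration space `ℝ³`. -/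
abbrev Space := EuclideanSpace ℝ (Fin 3)

/-- `N`-particle configuration space `ℝ^{3N}`, with the product Lebesgue measure. -/
abbrev Config (N : ℕ) := Fin N → Space

/-- The one-particle Hilbert space `L²(ℝ³)`. -/
abbrev OneBody := Lp ℂ 2 (volume : Measure Space)

/-- The `N`-particle Hilbert space `L²(ℝ^{3N})`. -/
abbrev ManyBody (N : ℕ) := Lp ℂ 2 (volume : Measure (Config N))

section Projections

variable {N : ℕ}

theorem measurable_lintegral_update (j : Fin N) {f : Config N → ℝ≥0∞} (hf : Measurable f) :
    Measurable fun x : Config N => ∫⁻ y, f (update x j y) :=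
  Measurable.lintegral_prod_right' (f := fun p : Config N × Space => f (update p.1 j p.2))
    (hf.comp measurable_update')

theorem lintegral_mul_lintegral_update (j : Fin N) {u : Space → ℝ≥0∞}
    {f : Config N → ℝ≥0∞} (hu : Measurable u) (hf : Measurable f) :
    ∫⁻ x : Config N, u (x j) * ∫⁻ y, f (update x j y) = (∫⁻ y, u y) * ∫⁻ x, f x := by
  have hu' : Measurable fun x : Config N => u (x j) := hu.comp (measurable_pi_apply j)
  rw [← lintegral_const_mul _ hf]
  refine lintegral_eq_of_lmarginal_eq (μ := fun _ : Fin N => (volume : Measure Space)) {j}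
    (hu'.mul (measurable_lintegral_update j hf)) (hf.const_mul _) ?_
  rw [lmarginal_singleton, lmarginal_singleton]
  funext x
  simp only [update_idem, update_self]
  have hx : Measurable fun y => f (update x j y) := hf.comp (measurable_update x)
  rw [lintegral_mul_const _ hu, lintegral_const_mul _ hx]

theorem ae_ae_update (j : Fin N) {P : Config N → Prop} (h : ∀ᵐ x, P x) :
    ∀ᵐ x : Config N, ∀ᵐ y : Space, P (update x j y) := by
  obtain ⟨S, hS, hSm, hS0⟩ := exists_measurable_superset_of_null (ae_iff.1 h)
  have hm : Measurable (S.indicator (1 : Config N → ℝ≥0∞)) := measurable_one.indicator hSm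
  have key := lintegral_mul_lintegral_update j (u := 1) measurable_one hm
  rw [lintegral_indicator_one hSm, hS0, mul_zero] at key
  simp only [Pi.one_apply, one_mul] at key
  filter_upwards [(lintegral_eq_zero_iff (measurable_lintegral_update j hm)).1 key] with x hx
  filter_upwards [(lintegral_eq_zero_iff (hm.comp (measurable_update x))).1 hx] with y hy
  by_contra hP
  have : update x j y ∈ S := hS hP
  simp [this] at hy

/-- The function `x ↦ φ(x_j) ∫ conj φ(y) Ψ(x_1, …, y, …, x_N) dy`, with `y` in the `j`-th place. -/
def projFun (j : Fin N) (φ : Space → ℂ) (Ψ : Config N → ℂ) (x : Config N) : ℂ :=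
  φ (x j) * ∫ y, conj (φ y) * Ψ (update x j y)

theorem lintegral_enorm_sq {α : Type*} [MeasurableSpace α] {μ : Measure α} (f : α → ℂ) :
    ∫⁻ x, ‖f x‖ₑ ^ 2 ∂μ = eLpNorm f 2 μ ^ 2 := by
  rw [eLpNorm_eq_lintegral_rpow_enorm_toReal (by norm_num) (by norm_num),
    ← ENNReal.rpow_natCast, ← ENNReal.rpow_mul]
  norm_num

theorem enorm_projFun_sq_le (j : Fin N) {φ : Space → ℂ} {Ψ : Config N → ℂ}
    (hφ : StronglyMeasurable φ) (hΨ : StronglyMeasurable Ψ) (x : Config N) :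
    ‖projFun j φ Ψ x‖ₑ ^ 2 ≤
      (∫⁻ y, ‖φ y‖ₑ ^ 2) * (‖φ (x j)‖ₑ ^ 2 * ∫⁻ y, ‖Ψ (update x j y)‖ₑ ^ 2) := by
  have hΨ' : Measurable fun y => ‖Ψ (update x j y)‖ₑ :=
    hΨ.measurable.enorm.comp (measurable_update x)
  have h1 : ‖∫ y, conj (φ y) * Ψ (update x j y)‖ₑ ≤ ∫⁻ y, ‖φ y‖ₑ * ‖Ψ (update x j y)‖ₑ := by
    refine (enorm_integral_le_lintegral_enorm _).trans (le_of_eq ?_)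
    simp
  have h2 := ENNReal.lintegral_mul_le_Lp_mul_Lq (volume : Measure Space)
    Real.HolderConjugate.two_two hφ.measurable.enorm.aemeasurable hΨ'.aemeasurable
  have h3 : ‖∫ y, conj (φ y) * Ψ (update x j y)‖ₑ ^ 2 ≤
      (∫⁻ y, ‖φ y‖ₑ ^ 2) * ∫⁻ y, ‖Ψ (update x j y)‖ₑ ^ 2 := by
    refine (pow_le_pow_left' (h1.trans h2) 2).trans (le_of_eq ?_)
    rw [mul_pow, ← ENNReal.rpow_natCast, ← ENNReal.rpow_natCast, ← ENNReal.rpow_mul,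
      ← ENNReal.rpow_mul]
    norm_num
  rw [projFun, enorm_mul, mul_pow]
  calc _ ≤ ‖φ (x j)‖ₑ ^ 2 * ((∫⁻ y, ‖φ y‖ₑ ^ 2) * ∫⁻ y, ‖Ψ (update x j y)‖ₑ ^ 2) := by gcongr
    _ = _ := by ring

theorem stronglyMeasurable_projFun (j : Fin N) {φ : Space → ℂ} {Ψ : Config N → ℂ}
    (hφ : StronglyMeasurable φ) (hΨ : StronglyMeasurable Ψ) :
    StronglyMeasurable (projFun j φ Ψ) := by
  refine (hφ.comp_measurable (measurable_pi_apply j)).mul ?_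
  refine StronglyMeasurable.integral_prod_right'
    (f := fun p : Config N × Space => conj (φ p.2) * Ψ (update p.1 j p.2)) ?_
  exact (RCLike.continuous_conj.comp_stronglyMeasurable (hφ.comp_measurable measurable_snd)).mul
    (hΨ.comp_measurable measurable_update')

theorem eLpNorm_projFun_le (j : Fin N) {φ : Space → ℂ} {Ψ : Config N → ℂ}
    (hφ : StronglyMeasurable φ) (hΨ : StronglyMeasurable Ψ) :
    eLpNorm (projFun j φ Ψ) 2 volume ≤ eLpNorm φ 2 volume ^ 2 * eLpNorm Ψ 2 volume := by
  rw [← ENNReal.pow_le_pow_left_iff two_ne_zero, ← lintegral_enorm_sq]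
  refine (lintegral_mono (enorm_projFun_sq_le j hφ hΨ)).trans (le_of_eq ?_)
  have hΨ2 : Measurable fun x => ‖Ψ x‖ₑ ^ 2 := hΨ.measurable.enorm.pow_const 2
  have hφ2 : Measurable fun x => ‖φ x‖ₑ ^ 2 := hφ.measurable.enorm.pow_const 2
  have hm : Measurable fun x : Config N => ‖φ (x j)‖ₑ ^ 2 * ∫⁻ y, ‖Ψ (update x j y)‖ₑ ^ 2 :=
    (hφ2.comp (measurable_pi_apply j)).mul (measurable_lintegral_update j hΨ2)
  rw [lintegral_const_mul _ hm,
    lintegral_mul_lintegral_update j hφ2 hΨ2, lintegral_enorm_sq, lintegral_enorm_sq]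
  ring

theorem ae_integrable_update (j : Fin N) {φ : Space → ℂ} {Ψ : Config N → ℂ}
    (hφ : MemLp φ 2) (hΨm : StronglyMeasurable Ψ) (hΨ : MemLp Ψ 2) :
    ∀ᵐ x : Config N, Integrable fun y => conj (φ y) * Ψ (update x j y) := by
  have hΨ2 : Measurable fun x => ‖Ψ x‖ₑ ^ 2 := hΨm.measurable.enorm.pow_const 2
  obtain ⟨u, hu0, hum, hu1⟩ :=
    exists_pos_lintegral_lt_of_sigmaFinite (volume : Measure Space) (ε := 1) one_ne_zero
  have key := lintegral_mul_lintegral_update j (u := fun y => (u y : ℝ≥0∞))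
    hum.coe_nnreal_ennreal hΨ2
  have hfin : ∀ᵐ x : Config N, (u (x j) : ℝ≥0∞) * ∫⁻ y, ‖Ψ (update x j y)‖ₑ ^ 2 < ⊤ := by
    refine ae_lt_top ((hum.coe_nnreal_ennreal.comp (measurable_pi_apply j)).mul
      (measurable_lintegral_update j hΨ2)) ?_
    rw [key, lintegral_enorm_sq]
    exact ENNReal.mul_ne_top (hu1.trans ENNReal.one_lt_top).ne
      (ENNReal.pow_ne_top hΨ.eLpNorm_ne_top)
  filter_upwards [hfin] with x hx
  have hx' : ∫⁻ y, ‖Ψ (update x j y)‖ₑ ^ 2 < ⊤ :=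
    ENNReal.lt_top_of_mul_ne_top_right hx.ne (ENNReal.coe_ne_zero.2 (hu0 (x j)).ne')
  rw [lintegral_enorm_sq (fun y => Ψ (update x j y))] at hx'
  have hm : MemLp (fun y => Ψ (update x j y)) 2 volume :=
    ⟨(hΨm.comp_measurable (measurable_update x)).aestronglyMeasurable, by
      by_contra h
      rw [not_lt, top_le_iff] at h
      simp [h] at hx'⟩
  exact MemLp.integrable_mul (p := 2) (q := 2) hφ.star hm

theorem memLp_projFun (j : Fin N) (φ : OneBody) (Ψ : ManyBody N) :
    MemLp (projFun j φ Ψ) 2 volume :=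
  ⟨(stronglyMeasurable_projFun j (Lp.stronglyMeasurable φ)
      (Lp.stronglyMeasurable Ψ)).aestronglyMeasurable,
    (eLpNorm_projFun_le j (Lp.stronglyMeasurable φ) (Lp.stronglyMeasurable Ψ)).trans_lt
      (ENNReal.mul_lt_top (ENNReal.pow_lt_top (Lp.memLp φ).eLpNorm_lt_top)
        (Lp.memLp Ψ).eLpNorm_lt_top)⟩

/-- The operator `p_j^φ = |φ(x_j)⟩⟨φ(x_j)|` on `L²(ℝ^{3N})`:
`(p_j^φ Ψ)(x) = φ(x_j) ∫ conj φ(x_j) Ψ(x_1, …, x_N) dx_j`. -/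
def proj (j : Fin N) (φ : OneBody) : ManyBody N →L[ℂ] ManyBody N :=
  LinearMap.mkContinuous
    { toFun := fun Ψ => MemLp.toLp (projFun j φ Ψ) (memLp_projFun j φ Ψ)
      map_add' := fun Ψ Ψ' => by
        rw [← MemLp.toLp_add, MemLp.toLp_eq_toLp_iff]
        filter_upwards [ae_ae_update j (Lp.coeFn_add Ψ Ψ'),
          ae_integrable_update j (Lp.memLp φ) (Lp.stronglyMeasurable Ψ) (Lp.memLp Ψ),
          ae_integrable_update j (Lp.memLp φ) (Lp.stronglyMeasurable Ψ') (Lp.memLp Ψ')]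
          with x hx h1 h2
        simp only [projFun, Pi.add_apply]
        rw [← mul_add, ← integral_add h1 h2]
        congr 1
        refine integral_congr_ae ?_
        filter_upwards [hx] with y hy
        rw [hy, Pi.add_apply, mul_add]
      map_smul' := fun c Ψ => by
        rw [RingHom.id_apply, ← MemLp.toLp_const_smul, MemLp.toLp_eq_toLp_iff]
        filter_upwards [ae_ae_update j (Lp.coeFn_smul c Ψ)] with x hx
        simp only [projFun, Pi.smul_apply, smul_eq_mul]
        rw [mul_left_comm, ← integral_const_mul c]
        congr 1
        refine integral_congr_ae ?_
        filter_upwards [hx] with y hy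
        rw [hy, Pi.smul_apply, smul_eq_mul]
        ring }
    (‖φ‖ ^ 2) fun Ψ => by
      simp only [LinearMap.coe_mk, AddHom.coe_mk]
      rw [Lp.norm_toLp, Lp.norm_def, Lp.norm_def, ← ENNReal.toReal_pow, ← ENNReal.toReal_mul]
      exact ENNReal.toReal_mono
        (ENNReal.mul_ne_top (ENNReal.pow_ne_top (Lp.memLp φ).eLpNorm_ne_top)
          (Lp.memLp Ψ).eLpNorm_ne_top)
        (eLpNorm_projFun_le j (Lp.stronglyMeasurable φ) (Lp.stronglyMeasurable Ψ))

/-- The operator `q_j^φ = 1 - p_j^φ`. -/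
def coproj (j : Fin N) (φ : OneBody) : ManyBody N →L[ℂ] ManyBody N :=
  1 - proj j φ

/-- The operator `P_{N,k}^φ`: the sum, over all sets `a` of `k` particles, of the product over the
particles `j = 1, …, N` of `q_j^φ` for `j ∈ a` and of `p_j^φ` for `j ∉ a`. -/
def countProj (N : ℕ) (k : ℕ) (φ : OneBody) : ManyBody N →L[ℂ] ManyBody N :=
  ∑ a ∈ (Finset.univ : Finset (Fin N)).powersetCard k,
    (List.ofFn fun j : Fin N => if j ∈ a then coproj j φ else proj j φ).prod

/-- The functional `α_N(Ψ, φ) = ⟪Ψ, ∑_{k = 0}^N n(k) P_{N,k}^φ Ψ⟫` with weight `n`. -/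
def alpha (N : ℕ) (n : ℕ → ℝ) (Ψ : ManyBody N) (φ : OneBody) : ℝ :=
  RCLike.re (inner ℂ Ψ (∑ k ∈ Finset.range (N + 1), (n k : ℂ) • countProj N k φ Ψ))

end Projections

section Dynamics

/-- The Laplacian `∑_j Δ_j` of a function of `N` particles in `ℝ³`. -/
def totalLaplacian (N : ℕ) (χ : Config N → ℂ) (x : Config N) : ℂ :=
  ∑ j : Fin N, Δ (fun y : Space => χ (update x j y)) (x j)

/-- `IsHamiltonianValue lap V f h`: the function `f ∈ L²` is in the natural domain of `-Δ + V`
(its distributional Laplacian `g` and its product `w` with `V` are in `L²`), and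
`(-Δ + V) f = h`. Here `lap` is the classical Laplacian, applied to test functions `χ`. -/
def IsHamiltonianValue {X : Type*} [NormedAddCommGroup X] [NormedSpace ℝ X] [MeasureSpace X]
    (lap : (X → ℂ) → X → ℂ) (V : X → ℝ) (f h : Lp ℂ 2 (volume : Measure X)) : Prop :=
  ∃ g w : Lp ℂ 2 (volume : Measure X),
    (∀ χ : X → ℂ, ContDiff ℝ ∞ χ → HasCompactSupport χ →
      ∫ x, f x * lap χ x = ∫ x, g x * χ x) ∧
    (∀ᵐ x, w x = (V x : ℂ) * f x) ∧
    h = -g + w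

/-- `f` is a strong solution of `i ∂_t f = (-Δ + V^t) f` on `[0, T]`: at every time it is in the
domain of `-Δ + V^t` and differentiable in `L²`, and the equation holds in `L²`
(with one-sided derivatives at the two ends). -/
def IsSolution {X : Type*} [NormedAddCommGroup X] [NormedSpace ℝ X] [MeasureSpace X]
    (lap : (X → ℂ) → X → ℂ) (V : ℝ → X → ℝ) (T : ℝ)
    (f : ℝ → Lp ℂ 2 (volume : Measure X)) : Prop :=
  ∀ t ∈ Set.Icc 0 T, ∃ f' : Lp ℂ 2 (volume : Measure X),
    HasDerivWithinAt f f' (Set.Icc 0 T) t ∧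
    IsHamiltonianValue lap (V t) (f t) (Complex.I • f')

/-- The potential `∑_{j < k} N⁻¹ v(x_j - x_k) + ∑_j A(x_j)` of the mean-field Hamiltonian `H_N`. -/
def manyBodyPotential (N : ℕ) (v A : Space → ℝ) (x : Config N) : ℝ :=
  (∑ j : Fin N, ∑ k ∈ Finset.Ioi j, (N : ℝ)⁻¹ * v (x j - x k)) + ∑ j : Fin N, A (x j)

/-- The potential `A + v ⋆ |φ|²` of the Hartree Hamiltonian. -/
def hartreePotential (v A : Space → ℝ) (φ : OneBody) (x : Space) : ℝ :=
  A x + (v ⋆[ContinuousLinearMap.mul ℝ ℝ, volume] fun y => ‖φ y‖ ^ 2) x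

/-- `Ψ` solves the `N`-body Schrödinger equation `i ∂_t Ψ = H_N Ψ` on `[0, T]`. -/
def SolvesSchrodinger (N : ℕ) (v : Space → ℝ) (A : ℝ → Space → ℝ) (T : ℝ)
    (Ψ : ℝ → ManyBody N) : Prop :=
  IsSolution (totalLaplacian N) (fun t => manyBodyPotential N v (A t)) T Ψ

/-- `φ` solves the Hartree equation `i ∂_t φ = (-Δ + A^t + v ⋆ |φ|²) φ` on `[0, T]`. -/
def SolvesHartree (v : Space → ℝ) (A : ℝ → Space → ℝ) (T : ℝ) (φ : ℝ → OneBody) : Prop :=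
  IsSolution (fun χ : Space → ℂ => Δ χ) (fun t => hartreePotential v (A t) (φ t)) T φ

/-- `Ψ` is symmetric under permutations of the particles. -/
def IsSymmetric {N : ℕ} (Ψ : ManyBody N) : Prop :=
  ∀ σ : Equiv.Perm (Fin N), ∀ᵐ x : Config N, Ψ (x ∘ σ) = Ψ x

end Dynamics

end MeanField

end

/-! Write `p`, `q` for `proj`, `coproj`. The counting operator satisfies `∑ k P_{N,k} = ∑ j, q_j`
(`sum_card_smul_prod_eq`), so for symmetric `Ψ` the functional equals `‖q_j Ψ‖² = 1 - ⟪Ψ, p_j Ψ⟫`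
for any single `j`. The aim is to differentiate this in time, to bound the derivative by `C (α +
1/N)`, and to apply Gronwall.

Solutions are only strong solutions in the distributional domain, so no propagator and no domain
invariance of `p_j` is available. Instead an additional particle in the state `φ` is adjoined: `⟪Ψ,
p_j Ψ⟫ = ⟪Ψ ⊗ φ, E_j (Ψ ⊗ φ)⟫`, where the unitary involution `E_j` exchanges particle `j` with the
additional one (`inner_tensor_exchangeL`). The product `Ψ ⊗ φ` solves a Schrödinger equation whose
Laplacian commutes with `E_j`. The kinetic energy therefore drops out of the derivative, by symmetry
of the weak Laplacian (`IsTestOperator.inner_eq`). The total potential becomes exchange invariant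
once the fluctuation `Q = N⁻¹ ∑ v(x_j - x_k) - v ⋆ |φ|²(x_j)` is subtracted, so only `-2 Im ⟪Q p_j
Ψ, Ψ⟫` is left (`re_inner_exchangeL_eq`).

Since `⟪Q p_j Ψ, p_j Ψ⟫` is real, one factor `q_j Ψ` appears. Each pair term `v(x_j - x_k) - v ⋆
|φ|²(x_j)` has mean zero in `x_k` against `|φ|²`. Hence `p_k Z_k p_k = 0` for the pair operators
`Z_k`; the vectors `Z_k p_k Ψ` are then nearly orthogonal for different `k`, and their sum is of
size `N √(‖qΨ‖² + 1/N)` (`norm_inner_sum_interaction_le`). Unbounded `v` is harmless because it acts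
after `p_j`: Hölder gives `‖v(a - ·) φ‖₂ ≤ ‖v‖_{2r} ‖φ‖_{2s}`. Normalisation and permutation
symmetry persist in time because real potentials conserve the `L²` norm. -/

noncomputable section

namespace MeanField

/-! ### Symmetry of weakly defined differential operators -/

section SymmetricOperators

variable {X : Type*} [NormedAddCommGroup X] [NormedSpace ℝ X]

/-- The properties of a constant-coefficient real differential operator with only even-order terms,
acting on smooth functions, that make it symmetric in `L²`. -/
structure IsTestOperator (lap : (X → ℂ) → X → ℂ) : Prop where
  continuous : ∀ χ, ContDiff ℝ ∞ χ → Continuous (lap χ)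
  hasCompactSupport : ∀ χ, ContDiff ℝ ∞ χ → HasCompactSupport χ → HasCompactSupport (lap χ)
  reflect : ∀ χ, ContDiff ℝ ∞ χ → ∀ a x, lap (fun y => χ (a - y)) x = lap χ (a - x)
  map_conj : ∀ χ, ContDiff ℝ ∞ χ → ∀ x, lap (fun y => conj (χ y)) x = conj (lap χ x)

/-- The function `g` is the value of the differential operator `lap` on `f` in the sense of
distributions. -/
def HasWeakValue [MeasureSpace X] (lap : (X → ℂ) → X → ℂ) (f g : X → ℂ) : Prop :=
  ∀ χ : X → ℂ, ContDiff ℝ ∞ χ → HasCompactSupport χ → ∫ x, f x * lap χ x = ∫ x, g x * χ x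

theorem HasWeakValue.congr [MeasureSpace X] {lap : (X → ℂ) → X → ℂ} {f g f' g' : X → ℂ}
    (h : HasWeakValue lap f g) (hf : f =ᵐ[volume] f') (hg : g =ᵐ[volume] g') :
    HasWeakValue lap f' g' := fun χ hχ hχc => by
  refine ((integral_congr_ae ?_).trans (h χ hχ hχc)).trans (integral_congr_ae ?_)
  · exact hf.symm.mul (ae_eq_refl (lap χ))
  · exact hg.mul (ae_eq_refl χ)

theorem HasWeakValue.conjugate [MeasureSpace X] {lap : (X → ℂ) → X → ℂ} (hl : IsTestOperator lap)
    {f g : X → ℂ} (h : HasWeakValue lap f g) :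
    HasWeakValue lap (fun x => conj (f x)) (fun x => conj (g x)) := fun χ hχ hχc => by
  have h1 := h (fun y => conj (χ y)) (Complex.conjCLE.contDiff.comp hχ)
    (hχc.comp_left (map_zero _))
  simp only [hl.map_conj χ hχ] at h1
  have h2 := congrArg conj h1
  rw [← integral_conj, ← integral_conj] at h2
  simpa using h2

theorem HasWeakValue.sub [MeasureSpace X] [BorelSpace X] [FiniteDimensional ℝ X]
    [IsLocallyFiniteMeasure (volume : Measure X)] {lap : (X → ℂ) → X → ℂ} (hl : IsTestOperator lap)
    {f g f' g' : X → ℂ} (hf : MemLp f 2 volume) (hg : MemLp g 2 volume)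
    (hf' : MemLp f' 2 volume) (hg' : MemLp g' 2 volume)
    (h : HasWeakValue lap f g) (h' : HasWeakValue lap f' g') :
    HasWeakValue lap (f - f') (g - g') := fun χ hχ hχc => by
  have h1 : MemLp (lap χ) 2 volume :=
    (hl.continuous χ hχ).memLp_of_hasCompactSupport (hl.hasCompactSupport χ hχ hχc)
  have h2 : MemLp χ 2 volume := hχ.continuous.memLp_of_hasCompactSupport hχc
  simp only [Pi.sub_apply, sub_mul]
  rw [integral_sub, integral_sub, h χ hχ hχc, h' χ hχ hχc]
  exacts [MemLp.integrable_mul (p := 2) (q := 2) hg h2,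
    MemLp.integrable_mul (p := 2) (q := 2) hg' h2,
    MemLp.integrable_mul (p := 2) (q := 2) hf h1, MemLp.integrable_mul (p := 2) (q := 2) hf' h1]

variable [MeasureSpace X] [BorelSpace X] [FiniteDimensional ℝ X]
  [(volume : Measure X).IsAddHaarMeasure]

/-- The product `‖f‖ ‖g‖` is dominated by `‖f‖² + ‖g‖²`, and the shear `(z, x) ↦ (z, x - z)`
preserves the product measure, so each square can be integrated separately. -/
theorem integrable_mul_mul_sub {ρ f g : X → ℂ} (hρ : Integrable ρ volume)
    (hf : MemLp f 2 volume) (hfm : StronglyMeasurable f)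
    (hg : MemLp g 2 volume) (hgm : StronglyMeasurable g) :
    Integrable (fun p : X × X => ρ p.1 * (f p.2 * g (p.2 - p.1))) (volume.prod volume) := by
  have hfi : Integrable (fun x => ‖f x‖ ^ 2) volume := hf.norm.integrable_sq
  have hgi : Integrable (fun x => ‖g x‖ ^ 2) volume := hg.norm.integrable_sq
  have h1 : Integrable (fun p : X × X => ‖ρ p.1‖ * ‖f p.2‖ ^ 2) (volume.prod volume) :=
    hρ.norm.mul_prod hfi
  have h2 : Integrable (fun p : X × X => ‖ρ p.1‖ * ‖g p.2‖ ^ 2) (volume.prod volume) :=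
    hρ.norm.mul_prod hgi
  have hm : MeasurePreserving (fun p : X × X => (p.1, -p.1 + p.2)) (volume.prod volume)
      (volume.prod volume) := measurePreserving_prod_neg_add volume volume
  have h3 := hm.integrable_comp_of_integrable h2
  refine (h1.add h3).mono' ?_ (Filter.Eventually.of_forall fun p => ?_)
  · refine hρ.aestronglyMeasurable.comp_fst.mul (StronglyMeasurable.aestronglyMeasurable ?_)
    exact (hfm.comp_measurable measurable_snd).mul
      (hgm.comp_measurable (measurable_snd.sub measurable_fst))
  · simp only [Pi.add_apply, comp_apply, norm_mul, neg_add_eq_sub]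
    rw [← mul_add]
    refine mul_le_mul_of_nonneg_left ?_ (norm_nonneg _)
    nlinarith [sq_nonneg (‖f p.2‖ - ‖g (p.2 - p.1)‖), norm_nonneg (f p.2),
      norm_nonneg (g (p.2 - p.1))]

/-- Translations act continuously on `L²`, and the correlation is an inner product of `star f` with
a translate of `g`. -/
theorem continuous_integral_mul_sub (f g : Lp ℂ 2 (volume : Measure X)) :
    Continuous fun z => ∫ x, f x * g (x - z) := by
  have hmp : ∀ z : X, MeasurePreserving (fun x : X => x - z) volume volume :=
    fun z => measurePreserving_sub_right volume z
  let G : X → C(X, X) := fun z => ⟨fun x => x - z, by fun_prop⟩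
  have hG : Continuous G := ContinuousMap.continuous_of_continuous_uncurry _ (by
    simp only [G, Function.uncurry_def, ContinuousMap.coe_mk]; fun_prop)
  have hc := Continuous.compMeasurePreservingLp (f := fun _ : X => g) (g := G) (μ := volume)
    (ν := volume) continuous_const hG hmp (by norm_num)
  have h2 : Continuous fun z => inner ℂ (star f) (Lp.compMeasurePreserving (G z) (hmp z) g) :=
    continuous_const.inner hc
  convert h2 using 2 with z
  rw [L2.inner_def]
  refine integral_congr_ae ?_
  filter_upwards [Lp.coeFn_star f, Lp.coeFn_compMeasurePreserving g (hmp z)] with x hx hx'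
  rw [hx]
  simp only [RCLike.inner_apply, Pi.star_apply, RCLike.star_def, Complex.conj_conj]
  rw [mul_comm]
  congr 1
  exact hx'.symm

/-- By Fubini the left side pairs `f` with the convolution of `g₁` and `ρ`. The reflected translates
of `ρ` are test functions, so the operator can be moved onto `ρ` without any regularity of `f`. -/
theorem integral_mul_correlation {lap : (X → ℂ) → X → ℂ} (hl : IsTestOperator lap)
    {f g g₁ : Lp ℂ 2 (volume : Measure X)} (hg : HasWeakValue lap g g₁) {ρ : X → ℂ}
    (hρ : ContDiff ℝ ∞ ρ) (hρc : HasCompactSupport ρ) :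
    ∫ z, ρ z * ∫ x, f x * g₁ (x - z) = ∫ z, lap ρ z * ∫ x, f x * g (x - z) := by
  have swap : ∀ (ρ : X → ℂ) (g : Lp ℂ 2 (volume : Measure X)), Integrable ρ volume →
      ∫ z, ρ z * ∫ x, f x * g (x - z) = ∫ x, f x * ∫ w, g w * ρ (x - w) := by
    intro ρ g hρ
    simp only [← integral_const_mul]
    rw [integral_integral_swap (integrable_mul_mul_sub hρ (Lp.memLp f) (Lp.stronglyMeasurable f)
      (Lp.memLp g) (Lp.stronglyMeasurable g))]
    congr 1
    ext x
    rw [← integral_sub_left_eq_self _ volume x]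
    congr 1
    ext w
    rw [sub_sub_cancel]
    ring
  rw [swap ρ g₁ (hρ.continuous.integrable_of_hasCompactSupport hρc),
    swap (lap ρ) g ((hl.continuous ρ hρ).integrable_of_hasCompactSupport
      (hl.hasCompactSupport ρ hρ hρc))]
  congr 1
  ext x
  have h1 := hg (fun w => ρ (x - w)) (hρ.comp (contDiff_const.sub contDiff_id))
    (hρc.comp_homeomorph (Homeomorph.subLeft x))
  simp only [hl.reflect ρ hρ] at h1
  rw [h1]

/-- Neither `f` nor `g` is a test function, so the definition of the weak value cannot be applied to
the pair directly. The correlations of `f₁, g` and of `f, g₁` agree as distributions in the shift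
`z`. Both are continuous in `z`, hence equal everywhere, and the value at `z = 0` is the claim. -/
theorem IsTestOperator.integral_mul_eq {lap : (X → ℂ) → X → ℂ} (hl : IsTestOperator lap)
    {f f₁ g g₁ : Lp ℂ 2 (volume : Measure X)} (hf : HasWeakValue lap f f₁)
    (hg : HasWeakValue lap g g₁) : ∫ x, f₁ x * g x = ∫ x, f x * g₁ x := by
  have hsymm : ∀ (f g : Lp ℂ 2 (volume : Measure X)) (z : X),
      ∫ x, f x * g (x - z) = ∫ x, g x * f (x - -z) := fun f g z => by
    rw [← integral_add_right_eq_self _ z]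
    simp [mul_comm]
  have hneg : ∀ ρ : X → ℂ, ContDiff ℝ ∞ ρ → ∀ x, lap (fun y => ρ (-y)) x = lap ρ (-x) :=
    fun ρ hρ x => by simpa using hl.reflect ρ hρ 0 x
  have key : ∀ ρ : X → ℂ, ContDiff ℝ ∞ ρ → HasCompactSupport ρ →
      ∫ z, ρ z * ∫ x, f₁ x * g (x - z) = ∫ z, ρ z * ∫ x, f x * g₁ (x - z) := by
    intro ρ hρ hρc
    rw [integral_mul_correlation hl hg hρ hρc]
    have h1 := integral_mul_correlation hl (f := g) hf (ρ := fun z => ρ (-z))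
      (hρ.comp contDiff_neg) (hρc.comp_homeomorph (Homeomorph.neg X))
    rw [← integral_neg_eq_self, ← integral_neg_eq_self (fun z => lap ρ z * _)]
    simp only [hneg ρ hρ] at h1
    simp only [hsymm _ g, neg_neg]
    exact h1
  have hae := ae_eq_of_integral_contDiff_smul_eq (μ := (volume : Measure X))
    (continuous_integral_mul_sub f₁ g).locallyIntegrable
    (continuous_integral_mul_sub f g₁).locallyIntegrable (fun ρ hρ hρc => by
      have := key (fun x => (ρ x : ℂ)) (Complex.ofRealCLM.contDiff.comp hρ)
        (hρc.comp_left (g := fun y : ℝ => (y : ℂ)) Complex.ofReal_zero)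
      simpa only [Complex.real_smul] using this)
  have := (Continuous.ae_eq_iff_eq volume (continuous_integral_mul_sub f₁ g)
    (continuous_integral_mul_sub f g₁)).1 hae
  simpa using congrFun this 0

theorem IsTestOperator.inner_eq {lap : (X → ℂ) → X → ℂ} (hl : IsTestOperator lap)
    {f f₁ g g₁ : Lp ℂ 2 (volume : Measure X)} (hf : HasWeakValue lap f f₁)
    (hg : HasWeakValue lap g g₁) : inner ℂ f₁ g = inner ℂ f g₁ := by
  have hs : HasWeakValue lap (star f : Lp ℂ 2 volume) (star f₁ : Lp ℂ 2 volume) :=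
    (hf.conjugate hl).congr (Lp.coeFn_star f).symm (Lp.coeFn_star f₁).symm
  have hi : ∀ u w : Lp ℂ 2 (volume : Measure X), inner ℂ u w = ∫ x, (star u : Lp ℂ 2 volume) x * w x := by
    intro u w
    rw [L2.inner_def]
    refine integral_congr_ae ?_
    filter_upwards [Lp.coeFn_star u] with x hx
    rw [hx, RCLike.inner_apply, mul_comm]
    rfl
  rw [hi, hi, hl.integral_mul_eq hs hg]

end SymmetricOperators

/-! ### Laplacians as symmetric test operators -/

section Laplacians

theorem two_le_smooth : ((2 : ℕ) : WithTop ℕ∞) ≤ ((⊤ : ℕ∞) : WithTop ℕ∞) :=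
  WithTop.coe_le_coe.2 le_top

variable {X : Type*} [NormedAddCommGroup X] [NormedSpace ℝ X]

theorem iteratedFDeriv_two_comp_affine {Y : Type*} [NormedAddCommGroup Y] [NormedSpace ℝ Y]
    {χ : X → ℂ} (hχ : ContDiff ℝ ∞ χ) (a : X) (L : Y →L[ℝ] X) (y u : Y) :
    iteratedFDeriv ℝ 2 (fun y => χ (a + L y)) y ![u, u] =
      iteratedFDeriv ℝ 2 χ (a + L y) ![L u, L u] := by
  have h := L.iteratedFDeriv_comp_right (f := fun z => χ (a + z)) (n := ∞)
    (hχ.comp (contDiff_const.add contDiff_id)) y (i := 2) two_le_smooth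
  rw [iteratedFDeriv_comp_add_left] at h
  have h' : (fun y => χ (a + L y)) = (fun z => χ (a + z)) ∘ L := rfl
  rw [h', h, ContinuousMultilinearMap.compContinuousLinearMap_apply]
  congr 1
  ext i
  fin_cases i <;> rfl

theorem isTestOperator_sum_iteratedFDeriv {ι : Type*} [Fintype ι] (e : ι → X) :
    IsTestOperator fun (χ : X → ℂ) x => ∑ i, iteratedFDeriv ℝ 2 χ x ![e i, e i] where
  continuous χ hχ := by
    refine continuous_finsetSum _ fun i _ => ?_
    have h : Continuous (iteratedFDeriv ℝ 2 χ) :=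
      hχ.continuous_iteratedFDeriv two_le_smooth
    exact (ContinuousMultilinearMap.apply ℝ (fun _ : Fin 2 => X) ℂ ![e i, e i]).continuous.comp h
  hasCompactSupport χ _ hc := by
    refine (hc.iteratedFDeriv (𝕜 := ℝ) 2).comp_left
      (g := fun M : X [×2]→L[ℝ] ℂ => ∑ i, M ![e i, e i]) ?_
    simp
  reflect χ hχ a x := by
    refine Finset.sum_congr rfl fun i _ => ?_
    have h := iteratedFDeriv_two_comp_affine hχ a (-ContinuousLinearMap.id ℝ X) x (e i)
    simp only [neg_apply, ContinuousLinearMap.id_apply, ← sub_eq_add_neg] at h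
    rw [h]
    -- The two minus signs cancel because the operator has even order.
    have h2 : ![-e i, -e i] = fun j => (-1 : ℝ) • (![e i, e i] : Fin 2 → X) j := by
      ext j; fin_cases j <;> simp
    rw [h2, ContinuousMultilinearMap.map_smul_univ]
    simp
  map_conj χ hχ x := by
    rw [map_sum]
    refine Finset.sum_congr rfl fun i _ => ?_
    have h := (Complex.conjCLE : ℂ →L[ℝ] ℂ).iteratedFDeriv_comp_left (f := χ) (x := x) (n := ∞)
      hχ.contDiffAt (i := 2) two_le_smooth
    have h' : (fun y => conj (χ y)) = (Complex.conjCLE : ℂ →L[ℝ] ℂ) ∘ χ := by ext y; simp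
    rw [h', h]
    simp

theorem IsTestOperator.congr {lap lap' : (X → ℂ) → X → ℂ} (h : IsTestOperator lap)
    (hl : ∀ χ, ContDiff ℝ ∞ χ → lap' χ = lap χ) : IsTestOperator lap' where
  continuous χ hχ := hl χ hχ ▸ h.continuous χ hχ
  hasCompactSupport χ hχ hc := hl χ hχ ▸ h.hasCompactSupport χ hχ hc
  reflect χ hχ a x := by
    rw [hl χ hχ, hl (fun y => χ (a - y)) (hχ.comp (contDiff_const.sub contDiff_id)), h.reflect χ hχ]
  map_conj χ hχ x := by
    rw [hl χ hχ, hl (fun y => conj (χ y)) (Complex.conjCLE.contDiff.comp hχ), h.map_conj χ hχ]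

theorem laplacian_comp_affine {χ : X → ℂ} (hχ : ContDiff ℝ ∞ χ) (a : X) (L : Space →L[ℝ] X)
    (y : Space) : Δ (fun y => χ (a + L y)) y = ∑ i, iteratedFDeriv ℝ 2 χ (a + L y)
      ![L (EuclideanSpace.basisFun (Fin 3) ℝ i), L (EuclideanSpace.basisFun (Fin 3) ℝ i)] := by
  rw [InnerProductSpace.laplacian_eq_iteratedFDeriv_orthonormalBasis _
    (EuclideanSpace.basisFun (Fin 3) ℝ)]
  exact Finset.sum_congr rfl fun i _ => iteratedFDeriv_two_comp_affine hχ a L y _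

theorem isTestOperator_laplacian : IsTestOperator fun χ : Space → ℂ => Δ χ :=
  (isTestOperator_sum_iteratedFDeriv (EuclideanSpace.basisFun (Fin 3) ℝ)).congr fun χ _ =>
    InnerProductSpace.laplacian_eq_iteratedFDeriv_orthonormalBasis χ _

theorem update_eq_add_single {N : ℕ} (x : Config N) (j : Fin N) (y : Space) :
    update x j y = update x j 0 + ContinuousLinearMap.single ℝ (fun _ : Fin N => Space) j y := by
  ext k : 1
  by_cases h : k = j
  · subst h; simp
  · simp [h]

theorem totalLaplacian_eq {N : ℕ} {χ : Config N → ℂ} (hχ : ContDiff ℝ ∞ χ) :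
    totalLaplacian N χ = fun x => ∑ p : Fin N × Fin 3, iteratedFDeriv ℝ 2 χ x
      ![Pi.single p.1 (EuclideanSpace.basisFun (Fin 3) ℝ p.2),
        Pi.single p.1 (EuclideanSpace.basisFun (Fin 3) ℝ p.2)] := by
  ext x
  rw [totalLaplacian, Fintype.sum_prod_type]
  refine Finset.sum_congr rfl fun j _ => ?_
  have h : (fun y => χ (update x j y)) = fun y => χ (update x j 0 +
      ContinuousLinearMap.single ℝ (fun _ : Fin N => Space) j y) := by
    ext y; rw [← update_eq_add_single]
  rw [h]
  rw [laplacian_comp_affine hχ, ← update_eq_add_single, update_eq_self]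
  rfl

theorem isTestOperator_totalLaplacian (N : ℕ) : IsTestOperator (totalLaplacian N) :=
  (isTestOperator_sum_iteratedFDeriv _).congr fun _ hχ => totalLaplacian_eq hχ

/-- The Laplacian of a function of `N` particles and one additional particle. -/
def augmentedLaplacian (N : ℕ) (χ : Config N × Space → ℂ) (p : Config N × Space) : ℂ :=
  totalLaplacian N (fun x => χ (x, p.2)) p.1 + Δ (fun y => χ (p.1, y)) p.2

theorem totalLaplacian_fst_eq {N : ℕ} {χ : Config N × Space → ℂ} (hχ : ContDiff ℝ ∞ χ)
    (p : Config N × Space) : totalLaplacian N (fun x => χ (x, p.2)) p.1 =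
      ∑ q : Fin N × Fin 3, iteratedFDeriv ℝ 2 χ p
        ![(Pi.single q.1 (EuclideanSpace.basisFun (Fin 3) ℝ q.2), 0),
          (Pi.single q.1 (EuclideanSpace.basisFun (Fin 3) ℝ q.2), 0)] := by
  have h : ∀ x, χ (x, p.2) = χ ((0, p.2) + ContinuousLinearMap.inl ℝ (Config N) Space x) :=
    fun x => by simp
  simp_rw [h]
  have hs : ContDiff ℝ ∞ fun x => χ ((0, p.2) + ContinuousLinearMap.inl ℝ (Config N) Space x) :=
    hχ.comp (contDiff_const.add (ContinuousLinearMap.inl ℝ (Config N) Space).contDiff)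
  rw [totalLaplacian_eq hs]
  refine Finset.sum_congr rfl fun i _ => ?_
  rw [iteratedFDeriv_two_comp_affine hχ]
  simp

theorem laplacian_snd_eq {N : ℕ} {χ : Config N × Space → ℂ} (hχ : ContDiff ℝ ∞ χ)
    (p : Config N × Space) : Δ (fun y => χ (p.1, y)) p.2 =
      ∑ i : Fin 3, iteratedFDeriv ℝ 2 χ p
        ![(0, EuclideanSpace.basisFun (Fin 3) ℝ i), (0, EuclideanSpace.basisFun (Fin 3) ℝ i)] := by
  have h : ∀ y, χ (p.1, y) = χ ((p.1, 0) + ContinuousLinearMap.inr ℝ (Config N) Space y) :=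
    fun x => by simp
  simp_rw [h]
  rw [laplacian_comp_affine hχ]
  simp

theorem isTestOperator_totalLaplacian_fst (N : ℕ) :
    IsTestOperator fun (χ : Config N × Space → ℂ) p => totalLaplacian N (fun x => χ (x, p.2)) p.1 :=
  (isTestOperator_sum_iteratedFDeriv _).congr fun _ hχ => funext (totalLaplacian_fst_eq hχ)

theorem isTestOperator_laplacian_snd (N : ℕ) :
    IsTestOperator fun (χ : Config N × Space → ℂ) p => Δ (fun y => χ (p.1, y)) p.2 :=
  (isTestOperator_sum_iteratedFDeriv _).congr fun _ hχ => funext (laplacian_snd_eq hχ)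

theorem IsTestOperator.add {lap lap' : (X → ℂ) → X → ℂ} (h : IsTestOperator lap)
    (h' : IsTestOperator lap') : IsTestOperator fun χ x => lap χ x + lap' χ x where
  continuous χ hχ := (h.continuous χ hχ).add (h'.continuous χ hχ)
  hasCompactSupport χ hχ hc := (h.hasCompactSupport χ hχ hc).add (h'.hasCompactSupport χ hχ hc)
  reflect χ hχ a x := by rw [h.reflect χ hχ, h'.reflect χ hχ]
  map_conj χ hχ x := by rw [h.map_conj χ hχ, h'.map_conj χ hχ, map_add]

theorem isTestOperator_augmentedLaplacian (N : ℕ) : IsTestOperator (augmentedLaplacian N) :=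
  (isTestOperator_totalLaplacian_fst N).add (isTestOperator_laplacian_snd N)

instance isAddHaarMeasure_config (N : ℕ) : (volume : Measure (Config N)).IsAddHaarMeasure :=
  inferInstanceAs (Measure.pi fun _ : Fin N => (volume : Measure Space)).IsAddHaarMeasure

instance isAddHaarMeasure_config_prod (N : ℕ) :
    (volume : Measure (Config N × Space)).IsAddHaarMeasure :=
  Measure.prod.instIsAddHaarMeasure (volume : Measure (Config N)) (volume : Measure Space)

end Laplacians

/-! ### Conservation of the norm and transport of solutions -/

section Dynamics

variable {X : Type*} [NormedAddCommGroup X] [NormedSpace ℝ X] [MeasureSpace X]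

theorem inner_mul_real_im_eq_zero {Y : Type*} [MeasureSpace Y] {V : Y → ℝ}
    {f w : Lp ℂ 2 (volume : Measure Y)}
    (hw : ∀ᵐ x, w x = (V x : ℂ) * f x) : (inner ℂ f w).im = 0 := by
  have h : inner ℂ f w = ((∫ x, V x * ‖f x‖ ^ 2 : ℝ) : ℂ) := by
    rw [L2.inner_def, ← integral_complex_ofReal]
    refine integral_congr_ae ?_
    filter_upwards [hw] with x hx
    rw [hx, RCLike.inner_apply, mul_assoc, Complex.mul_conj, Complex.normSq_eq_norm_sq]
    push_cast
    rfl
  rw [h, Complex.ofReal_im]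

theorem IsHamiltonianValue.inner_im_eq_zero [BorelSpace X] [FiniteDimensional ℝ X]
    [(volume : Measure X).IsAddHaarMeasure] {lap : (X → ℂ) → X → ℂ} (hl : IsTestOperator lap)
    {V : X → ℝ} {f h : Lp ℂ 2 (volume : Measure X)} (hf : IsHamiltonianValue lap V f h) :
    (inner ℂ f h).im = 0 := by
  obtain ⟨g, w, hg, hw, rfl⟩ := hf
  have h1 : (inner ℂ f g).im = 0 := by
    have h := hl.inner_eq (f := f) (g := f) hg hg
    rw [← inner_conj_symm] at h
    exact Complex.conj_eq_iff_im.1 h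
  rw [inner_add_right, inner_neg_right, Complex.add_im, Complex.neg_im, h1,
    inner_mul_real_im_eq_zero hw]
  simp

theorem norm_eq_of_re_inner_deriv_eq_zero {H : Type*} [NormedAddCommGroup H]
    [InnerProductSpace ℂ H] {T : ℝ} {f : ℝ → H}
    (hf : ∀ t ∈ Set.Icc 0 T, ∃ f' : H, HasDerivWithinAt f f' (Set.Icc 0 T) t ∧
      (inner ℂ (f t) f').re = 0) : ∀ t ∈ Set.Icc 0 T, ‖f t‖ = ‖f 0‖ := by
  intro t ht
  have key : ∀ t ∈ Set.Icc 0 T, HasDerivWithinAt (fun t => ‖f t‖ ^ 2) 0 (Set.Icc 0 T) t := by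
    intro t ht
    obtain ⟨f', h1, h2⟩ := hf t ht
    have h3 := (h1.inner ℂ h1)
    have h4 := Complex.reCLM.hasFDerivAt.comp_hasDerivWithinAt t h3
    have e1 : Complex.reCLM (inner ℂ (f t) f' + inner ℂ f' (f t)) = 0 := by
      rw [← inner_conj_symm f' (f t)]
      simp only [map_add, Complex.reCLM_apply, Complex.conj_re, h2, add_zero]
    have e2 : (fun t => ‖f t‖ ^ 2) = Complex.reCLM ∘ fun t => inner ℂ (f t) (f t) := by
      ext s
      exact (inner_self_eq_norm_sq (𝕜 := ℂ) (f s)).symm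
    rw [e1] at h4
    rw [e2]
    exact h4
  have hc := constant_of_derivWithin_zero (fun t ht => (key t ht).differentiableWithinAt)
    (fun s hs => (key s ⟨hs.1, hs.2.le⟩).derivWithin
      ((uniqueDiffOn_Icc (hs.1.trans_lt hs.2)) s ⟨hs.1, hs.2.le⟩)) t ht
  simpa [pow_left_inj₀] using hc

theorem IsSolution.norm_eq [BorelSpace X] [FiniteDimensional ℝ X]
    [(volume : Measure X).IsAddHaarMeasure] {lap : (X → ℂ) → X → ℂ} (hl : IsTestOperator lap)
    {V : ℝ → X → ℝ} {T : ℝ} {f : ℝ → Lp ℂ 2 (volume : Measure X)} (hf : IsSolution lap V T f) :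
    ∀ t ∈ Set.Icc 0 T, ‖f t‖ = ‖f 0‖ := by
  refine norm_eq_of_re_inner_deriv_eq_zero fun t ht => ?_
  obtain ⟨f', h1, h2⟩ := hf t ht
  refine ⟨f', h1, ?_⟩
  have := h2.inner_im_eq_zero hl
  rw [inner_smul_right] at this
  simpa using this

theorem IsSolution.sub [BorelSpace X] [FiniteDimensional ℝ X]
    [(volume : Measure X).IsAddHaarMeasure] {lap : (X → ℂ) → X → ℂ} (hl : IsTestOperator lap)
    {V : ℝ → X → ℝ} {T : ℝ} {f g : ℝ → Lp ℂ 2 (volume : Measure X)} (hf : IsSolution lap V T f)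
    (hg : IsSolution lap V T g) : IsSolution lap V T (fun t => f t - g t) := by
  intro t ht
  obtain ⟨f', hf1, gf, wf, hf2, hf3, hf4⟩ := hf t ht
  obtain ⟨g', hg1, gg, wg, hg2, hg3, hg4⟩ := hg t ht
  refine ⟨f' - g', hf1.sub hg1, gf - gg, wf - wg, ?_, ?_, ?_⟩
  · have h : HasWeakValue lap (f t - g t) (gf - gg) := HasWeakValue.sub hl (Lp.memLp _)
      (Lp.memLp _) (Lp.memLp _) (Lp.memLp _) hf2 hg2
    exact h.congr (Lp.coeFn_sub (f t) (g t)).symm (Lp.coeFn_sub gf gg).symm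
  · filter_upwards [hf3, hg3, Lp.coeFn_sub (f t) (g t), Lp.coeFn_sub wf wg] with x h1 h2 h3 h4
    rw [h3, h4, Pi.sub_apply, Pi.sub_apply, h1, h2, mul_sub]
  · rw [smul_sub, hf4, hg4]
    abel

theorem HasWeakValue.comp_homeomorph [BorelSpace X] {lap : (X → ℂ) → X → ℂ} {f g : X → ℂ}
    (h : HasWeakValue lap f g) (e : X ≃ₜ X) (he : MeasurePreserving e volume volume)
    (hs : ContDiff ℝ ∞ e.symm)
    (hl : ∀ χ : X → ℂ, ContDiff ℝ ∞ χ → ∀ x, lap (fun y => χ (e.symm y)) (e x) = lap χ x) :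
    HasWeakValue lap (fun x => f (e x)) (fun x => g (e x)) := fun χ hχ hχc => by
  have h1 := h (fun y => χ (e.symm y)) (hχ.comp hs) (hχc.comp_homeomorph e.symm)
  rw [← he.integral_comp e.measurableEmbedding,
    ← he.integral_comp e.measurableEmbedding (fun x => g x * χ (e.symm x))] at h1
  simpa [hl χ hχ] using h1

theorem IsSolution.comp_homeomorph [BorelSpace X] {lap : (X → ℂ) → X → ℂ} {V : ℝ → X → ℝ} {T : ℝ}
    {f : ℝ → Lp ℂ 2 (volume : Measure X)} (h : IsSolution lap V T f) (e : X ≃ₜ X)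
    (he : MeasurePreserving e volume volume) (hs : ContDiff ℝ ∞ e.symm)
    (hl : ∀ χ : X → ℂ, ContDiff ℝ ∞ χ → ∀ x, lap (fun y => χ (e.symm y)) (e x) = lap χ x)
    (hV : ∀ t x, V t (e x) = V t x) :
    IsSolution lap V T (fun t => Lp.compMeasurePreservingₗᵢ ℂ e he (f t)) := by
  intro t ht
  obtain ⟨f', hf1, g, w, hf2, hf3, hf4⟩ := h t ht
  let L : Lp ℂ 2 (volume : Measure X) →L[ℝ] Lp ℂ 2 (volume : Measure X) :=
    (Lp.compMeasurePreservingₗᵢ ℂ e he).toContinuousLinearMap.restrictScalars ℝ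
  refine ⟨Lp.compMeasurePreservingₗᵢ ℂ e he f',
    L.hasFDerivAt.comp_hasDerivWithinAt t hf1,
    Lp.compMeasurePreservingₗᵢ ℂ e he g, Lp.compMeasurePreservingₗᵢ ℂ e he w, ?_, ?_, ?_⟩
  · have h2 : HasWeakValue lap (f t) g := hf2
    exact (h2.comp_homeomorph e he hs hl).congr (Lp.coeFn_compMeasurePreserving (f t) he).symm
      (Lp.coeFn_compMeasurePreserving g he).symm
  · have h3 : ∀ᵐ x, w (e x) = (V t (e x) : ℂ) * f t (e x) := he.quasiMeasurePreserving.ae hf3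
    filter_upwards [h3, Lp.coeFn_compMeasurePreserving (f t) he,
      Lp.coeFn_compMeasurePreserving w he] with x h1 h2 h3
    refine h3.trans ?_
    simp only [comp_apply, h1, hV]
    congr 1
    exact h2.symm
  · rw [← map_smul, hf4, map_add, map_neg]

end Dynamics

/-! ### Permutation symmetry is preserved in time -/

section Permutations

variable {N : ℕ}

/-- Permutation of the particles. -/
def permHomeomorph (σ : Equiv.Perm (Fin N)) : Config N ≃ₜ Config N where
  toFun x := x ∘ σ
  invFun x := x ∘ σ.symm
  left_inv x := by ext i : 1; simp
  right_inv x := by ext i : 1; simp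
  continuous_toFun := by fun_prop
  continuous_invFun := by fun_prop

theorem measurePreserving_permHomeomorph (σ : Equiv.Perm (Fin N)) :
    MeasurePreserving (permHomeomorph σ) volume volume := by
  have h := volume_measurePreserving_piCongrLeft (fun _ : Fin N => Space) σ.symm
  convert h using 1
  ext x i : 2
  have := MeasurableEquiv.piCongrLeft_apply_apply (β := fun _ : Fin N => Space) σ.symm x (σ i)
  simp only [Equiv.symm_apply_apply] at this
  exact this.symm

theorem totalLaplacian_perm (σ : Equiv.Perm (Fin N)) (χ : Config N → ℂ) (x : Config N) :
    totalLaplacian N (fun y => χ ((permHomeomorph σ).symm y)) (permHomeomorph σ x) =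
      totalLaplacian N χ x := by
  have hs : ∀ y, (permHomeomorph σ).symm y = y ∘ σ.symm := fun _ => rfl
  have he : permHomeomorph σ x = x ∘ σ := rfl
  simp only [totalLaplacian, hs, he, update_comp_equiv, Equiv.symm_symm]
  rw [← Equiv.sum_comp σ (fun j => Δ (fun y => χ (update x j y)) (x j))]
  refine Finset.sum_congr rfl fun j _ => ?_
  have h : (x ∘ σ) ∘ σ.symm = x := by ext i : 1; simp
  rw [h, comp_apply]

/-- The sum over ordered pairs does not refer to the order of `Fin N`, so it can be reindexed by a
permutation and split at any particle. -/
theorem sum_Ioi_eq_half_sum {N : ℕ} (u : Fin N → Fin N → ℝ) (hu : ∀ j k, u j k = u k j) :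
    ∑ j, ∑ k ∈ Finset.Ioi j, u j k = 2⁻¹ * ∑ j, ∑ k ∈ Finset.univ.erase j, u j k := by
  have h1 : ∀ j : Fin N, ∑ k ∈ Finset.univ.erase j, u j k =
      ∑ k ∈ Finset.Ioi j, u j k + ∑ k ∈ Finset.Iio j, u j k := by
    intro j
    rw [← Finset.sum_union]
    · congr 1
      ext k
      simp [lt_or_lt_iff_ne, eq_comm]
    · rw [Finset.disjoint_left]
      intro k hk hk'
      simp only [Finset.mem_Ioi, Finset.mem_Iio] at hk hk'
      exact absurd hk hk'.not_gt
  have h2 : ∑ j, ∑ k ∈ Finset.Iio j, u j k = ∑ j, ∑ k ∈ Finset.Ioi j, u j k := by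
    rw [Finset.sum_comm' (t' := Finset.univ) (s' := fun k => Finset.Ioi k) (by simp)]
    simp_rw [hu]
  simp_rw [h1]
  rw [Finset.sum_add_distrib, h2]
  ring

theorem manyBodyPotential_eq {v : Space → ℝ} (hv : ∀ x, v (-x) = v x) (A : Space → ℝ)
    (x : Config N) : manyBodyPotential N v A x =
      2⁻¹ * (∑ j, ∑ k ∈ Finset.univ.erase j, (N : ℝ)⁻¹ * v (x j - x k)) + ∑ j, A (x j) := by
  rw [manyBodyPotential, sum_Ioi_eq_half_sum]
  intro j k
  rw [← hv (x k - x j), neg_sub]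

theorem manyBodyPotential_perm {v : Space → ℝ} (hv : ∀ x, v (-x) = v x) (A : Space → ℝ)
    (σ : Equiv.Perm (Fin N)) (x : Config N) :
    manyBodyPotential N v A (permHomeomorph σ x) = manyBodyPotential N v A x := by
  have he : ∀ j, permHomeomorph σ x j = x (σ j) := fun _ => rfl
  simp only [manyBodyPotential_eq hv, he]
  rw [Equiv.sum_comp σ (fun j => A (x j)),
    ← Equiv.sum_comp σ (fun j => ∑ k ∈ Finset.univ.erase j, (N : ℝ)⁻¹ * v (x j - x k))]
  congr 3
  ext j
  refine Finset.sum_bij (fun k _ => σ k) ?_ ?_ ?_ ?_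
  · simp
  · simp
  · intro k hk
    exact ⟨σ.symm k, by simpa [Equiv.symm_apply_eq] using hk, by simp⟩
  · simp

/-- The permuted wave function solves the same equation, whose potential is permutation invariant.
The difference of the two solutions vanishes at time `0` and, by linearity, has constant norm. -/
theorem SolvesSchrodinger.isSymmetric {v : Space → ℝ} (hv : ∀ x, v (-x) = v x)
    {A : ℝ → Space → ℝ} {T : ℝ} {Ψ : ℝ → ManyBody N} (h : SolvesSchrodinger N v A T Ψ)
    (h0 : IsSymmetric (Ψ 0)) : ∀ t ∈ Set.Icc 0 T, IsSymmetric (Ψ t) := by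
  intro t ht σ
  have hσ := measurePreserving_permHomeomorph σ
  have hs : ContDiff ℝ ∞ (permHomeomorph σ).symm := by
    have : ⇑(permHomeomorph σ).symm = fun x : Config N => x ∘ σ.symm := rfl
    rw [this]
    exact contDiff_pi.2 fun i => contDiff_apply ℝ Space _
  have h1 := IsSolution.comp_homeomorph h (permHomeomorph σ) hσ hs
    (fun χ _ x => totalLaplacian_perm σ χ x) (fun t x => manyBodyPotential_perm hv (A t) σ x)
  have h2 := (h1.sub (isTestOperator_totalLaplacian N) h).norm_eq
    (isTestOperator_totalLaplacian N) t ht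
  have h3 : Lp.compMeasurePreservingₗᵢ ℂ (permHomeomorph σ) hσ (Ψ 0) = Ψ 0 := by
    refine Lp.ext ((Lp.coeFn_compMeasurePreserving (Ψ 0) hσ).trans ?_)
    exact h0 σ
  simp only [h3, sub_self, norm_zero, norm_eq_zero, sub_eq_zero] at h2
  have h4 := Lp.coeFn_compMeasurePreserving (Ψ t) hσ
  have h5 : Lp.compMeasurePreserving (permHomeomorph σ) hσ (Ψ t) = Ψ t := h2
  rw [h5] at h4
  exact h4.symm

end Permutations

/-! ### Adjoining an additional particle -/

section Tensor

variable {N : ℕ}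

/-- The Hilbert space of `N` particles and one additional particle. -/
abbrev AugmentedBody (N : ℕ) := Lp ℂ 2 (volume : Measure (Config N × Space))

theorem memLp_tensor (Ψ : ManyBody N) (φ : OneBody) :
    MemLp (fun p : Config N × Space => Ψ p.1 * φ p.2) 2 volume := by
  rw [memLp_two_iff_integrable_sq_norm]
  · simp only [norm_mul, mul_pow]
    exact Integrable.mul_prod (Lp.memLp Ψ).norm.integrable_sq (Lp.memLp φ).norm.integrable_sq
  · exact (((Lp.stronglyMeasurable Ψ).comp_measurable measurable_fst).mul
      ((Lp.stronglyMeasurable φ).comp_measurable measurable_snd)).aestronglyMeasurable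

theorem norm_sq_eq_integral {Y : Type*} [MeasureSpace Y] (f : Lp ℂ 2 (volume : Measure Y)) :
    ‖f‖ ^ 2 = ∫ x, ‖f x‖ ^ 2 := by
  have h := inner_self_eq_norm_sq (𝕜 := ℂ) f
  rw [← h, L2.inner_def, ← integral_re (L2.integrable_inner f f)]
  exact integral_congr_ae (Filter.Eventually.of_forall fun x => inner_self_eq_norm_sq (𝕜 := ℂ) (f x))

/-- The product wave function `Ψ ⊗ φ`. -/
def tensor (Ψ : ManyBody N) (φ : OneBody) : AugmentedBody N := (memLp_tensor Ψ φ).toLp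

theorem coeFn_tensor (Ψ : ManyBody N) (φ : OneBody) :
    tensor Ψ φ =ᵐ[volume] fun p => Ψ p.1 * φ p.2 := MemLp.coeFn_toLp _

theorem ae_fst {P : Config N → Prop} (h : ∀ᵐ x, P x) :
    ∀ᵐ p : Config N × Space, P p.1 := Measure.quasiMeasurePreserving_fst.ae h

theorem ae_snd {P : Space → Prop} (h : ∀ᵐ x, P x) :
    ∀ᵐ p : Config N × Space, P p.2 := Measure.quasiMeasurePreserving_snd.ae h

theorem norm_tensor (Ψ : ManyBody N) (φ : OneBody) : ‖tensor Ψ φ‖ = ‖Ψ‖ * ‖φ‖ := by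
  rw [← pow_left_inj₀ (norm_nonneg _) (by positivity) two_ne_zero, mul_pow,
    norm_sq_eq_integral, norm_sq_eq_integral, norm_sq_eq_integral, ← integral_prod_mul]
  refine integral_congr_ae ?_
  filter_upwards [coeFn_tensor Ψ φ] with p hp
  rw [hp, norm_mul, mul_pow]

theorem add_tensor (Ψ Ψ' : ManyBody N) (φ : OneBody) :
    tensor (Ψ + Ψ') φ = tensor Ψ φ + tensor Ψ' φ := by
  apply Lp.ext
  filter_upwards [coeFn_tensor (Ψ + Ψ') φ, coeFn_tensor Ψ φ, coeFn_tensor Ψ' φ,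
    ae_fst (Lp.coeFn_add Ψ Ψ'), Lp.coeFn_add (tensor Ψ φ) (tensor Ψ' φ)] with p h1 h2 h3 h4 h5
  rw [h1, h5, Pi.add_apply, h2, h3, h4, Pi.add_apply, add_mul]

theorem tensor_add (Ψ : ManyBody N) (φ φ' : OneBody) :
    tensor Ψ (φ + φ') = tensor Ψ φ + tensor Ψ φ' := by
  apply Lp.ext
  filter_upwards [coeFn_tensor Ψ (φ + φ'), coeFn_tensor Ψ φ, coeFn_tensor Ψ φ',
    ae_snd (Lp.coeFn_add φ φ'), Lp.coeFn_add (tensor Ψ φ) (tensor Ψ φ')] with p h1 h2 h3 h4 h5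
  rw [h1, h5, Pi.add_apply, h2, h3, h4, Pi.add_apply, mul_add]

theorem smul_tensor (c : ℂ) (Ψ : ManyBody N) (φ : OneBody) :
    tensor (c • Ψ) φ = c • tensor Ψ φ := by
  apply Lp.ext
  filter_upwards [coeFn_tensor (c • Ψ) φ, coeFn_tensor Ψ φ,
    ae_fst (Lp.coeFn_smul c Ψ), Lp.coeFn_smul c (tensor Ψ φ)] with p h1 h2 h3 h4
  rw [h1, h4, Pi.smul_apply, h2, h3, Pi.smul_apply, smul_mul_assoc]

theorem tensor_smul (c : ℂ) (Ψ : ManyBody N) (φ : OneBody) :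
    tensor Ψ (c • φ) = c • tensor Ψ φ := by
  apply Lp.ext
  filter_upwards [coeFn_tensor Ψ (c • φ), coeFn_tensor Ψ φ,
    ae_snd (Lp.coeFn_smul c φ), Lp.coeFn_smul c (tensor Ψ φ)] with p h1 h2 h3 h4
  rw [h1, h4, Pi.smul_apply, h2, h3, Pi.smul_apply, mul_smul_comm]

theorem _root_.IsBoundedBilinearMap.hasDerivWithinAt_comp {E F G : Type*} [NormedAddCommGroup E]
    [NormedSpace ℝ E] [NormedAddCommGroup F] [NormedSpace ℝ F] [NormedAddCommGroup G]
    [NormedSpace ℝ G] {b : E × F → G} (hb : IsBoundedBilinearMap ℝ b) {f : ℝ → E} {g : ℝ → F}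
    {f' : E} {g' : F} {s : Set ℝ} {t : ℝ} (hf : HasDerivWithinAt f f' s t)
    (hg : HasDerivWithinAt g g' s t) :
    HasDerivWithinAt (fun t => b (f t, g t)) (b (f t, g') + b (f', g t)) s t :=
  HasFDerivAt.comp_hasDerivWithinAt (f := fun t => (f t, g t)) t (hb.hasFDerivAt (f t, g t))
    (hf.prodMk hg)

theorem isBoundedBilinearMap_tensor (N : ℕ) :
    IsBoundedBilinearMap ℝ fun p : ManyBody N × OneBody => tensor p.1 p.2 where
  add_left := add_tensor
  smul_left c Ψ φ := by
    rw [RCLike.real_smul_eq_coe_smul (K := ℂ), smul_tensor, ← RCLike.real_smul_eq_coe_smul]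
  add_right := tensor_add
  smul_right c Ψ φ := by
    rw [RCLike.real_smul_eq_coe_smul (K := ℂ), tensor_smul, ← RCLike.real_smul_eq_coe_smul]
  bound := ⟨1, one_pos, fun Ψ φ => by rw [one_mul, norm_tensor]⟩

theorem hasDerivWithinAt_tensor {Ψ : ℝ → ManyBody N} {φ : ℝ → OneBody} {Ψ' : ManyBody N}
    {φ' : OneBody} {s : Set ℝ} {t : ℝ} (hΨ : HasDerivWithinAt Ψ Ψ' s t)
    (hφ : HasDerivWithinAt φ φ' s t) :
    HasDerivWithinAt (fun t => tensor (Ψ t) (φ t)) (tensor (Ψ t) φ' + tensor Ψ' (φ t)) s t := by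
  have h := (isBoundedBilinearMap_tensor N).hasDerivWithinAt_comp hΨ hφ
  exact h

/-- Slices of a test function are test functions, so Fubini reduces each half of the Laplacian to
the weak identity for one factor. -/
theorem hasWeakValue_tensor {Ψ g : ManyBody N} {φ k : OneBody}
    (hΨ : HasWeakValue (totalLaplacian N) Ψ g) (hφ : HasWeakValue (fun χ : Space → ℂ => Δ χ) φ k) :
    HasWeakValue (augmentedLaplacian N) (tensor Ψ φ) (tensor g φ + tensor Ψ k : AugmentedBody N) := by
  intro χ hχ hχc
  have hχ2 : MemLp χ 2 volume := hχ.continuous.memLp_of_hasCompactSupport hχc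
  have h1 := isTestOperator_totalLaplacian_fst N
  have h2 := isTestOperator_laplacian_snd N
  have h1' := (h1.continuous χ hχ).memLp_of_hasCompactSupport (p := 2) (μ := volume)
    (h1.hasCompactSupport χ hχ hχc)
  have h2' := (h2.continuous χ hχ).memLp_of_hasCompactSupport (p := 2) (μ := volume)
    (h2.hasCompactSupport χ hχ hχc)
  have hfst : ∀ y, HasCompactSupport fun x => χ (x, y) := fun y =>
    HasCompactSupport.intro (hχc.isCompact.image continuous_fst) fun x hx => by
      by_contra h
      exact hx ⟨(x, y), subset_closure h, rfl⟩
  have hsnd : ∀ x, HasCompactSupport fun y => χ (x, y) := fun x =>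
    HasCompactSupport.intro (hχc.isCompact.image continuous_snd) fun y hy => by
      by_contra h
      exact hy ⟨(x, y), subset_closure h, rfl⟩
  have hint : ∀ (Ψ : ManyBody N) (φ : OneBody) {u : Config N × Space → ℂ}, MemLp u 2 volume →
      Integrable (fun p => Ψ p.1 * φ p.2 * u p) volume := fun Ψ φ u hu =>
    MemLp.integrable_mul (p := 2) (q := 2) (memLp_tensor Ψ φ) hu
  have hA : ∫ p : Config N × Space, Ψ p.1 * φ p.2 * totalLaplacian N (fun x => χ (x, p.2)) p.1 =
      ∫ p : Config N × Space, g p.1 * φ p.2 * χ p := by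
    rw [Measure.volume_eq_prod, integral_prod_symm _ (hint Ψ φ h1'),
      integral_prod_symm _ (hint g φ hχ2)]
    congr 1
    ext y
    simp only [mul_comm _ (φ y), mul_assoc]
    rw [integral_const_mul, integral_const_mul]
    congr 1
    exact hΨ (fun x => χ (x, y)) (hχ.comp (contDiff_id.prodMk contDiff_const)) (hfst y)
  have hB : ∫ p : Config N × Space, Ψ p.1 * φ p.2 * Δ (fun y => χ (p.1, y)) p.2 =
      ∫ p : Config N × Space, Ψ p.1 * k p.2 * χ p := by
    rw [Measure.volume_eq_prod, integral_prod _ (hint Ψ φ h2'), integral_prod _ (hint Ψ k hχ2)]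
    congr 1
    ext x
    simp only [mul_assoc]
    rw [integral_const_mul, integral_const_mul]
    congr 1
    exact hφ (fun y => χ (x, y)) (hχ.comp (contDiff_const.prodMk contDiff_id)) (hsnd x)
  calc ∫ p, tensor Ψ φ p * augmentedLaplacian N χ p
      = ∫ p : Config N × Space, (Ψ p.1 * φ p.2 * totalLaplacian N (fun x => χ (x, p.2)) p.1 +
        Ψ p.1 * φ p.2 * Δ (fun y => χ (p.1, y)) p.2) := by
        refine integral_congr_ae ?_
        filter_upwards [coeFn_tensor Ψ φ] with p hp
        rw [hp, augmentedLaplacian, mul_add]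
    _ = ∫ p : Config N × Space, (g p.1 * φ p.2 * χ p + Ψ p.1 * k p.2 * χ p) := by
        rw [integral_add (hint Ψ φ h1') (hint Ψ φ h2'), hA, hB,
          integral_add (hint g φ hχ2) (hint Ψ k hχ2)]
    _ = _ := by
        refine integral_congr_ae ?_
        filter_upwards [coeFn_tensor g φ, coeFn_tensor Ψ k,
          Lp.coeFn_add (tensor g φ) (tensor Ψ k)] with p h1 h2 h3
        rw [h3, Pi.add_apply, h1, h2, add_mul]

end Tensor

/-! ### The exchange operator represents the projection -/

section Exchange

variable {N : ℕ}

/-- Exchange of the particle `j` with the additional particle. -/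
def exchange (j : Fin N) : Config N × Space ≃ₜ Config N × Space where
  toFun p := (update p.1 j p.2, p.1 j)
  invFun p := (update p.1 j p.2, p.1 j)
  left_inv p := by simp
  right_inv p := by simp
  continuous_toFun := by fun_prop
  continuous_invFun := by fun_prop

theorem exchange_apply (j : Fin N) (p : Config N × Space) :
    exchange j p = (update p.1 j p.2, p.1 j) := rfl

theorem exchange_symm (j : Fin N) : (exchange j).symm = exchange j := rfl

theorem exchange_exchange (j : Fin N) (p : Config N × Space) :
    exchange j (exchange j p) = p := (exchange j).left_inv p

/-- With all coordinates other than the `j`-th fixed, this is Tonelli for the two exchanged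
variables. -/
theorem lintegral_exchange (j : Fin N) {f : Config N × Space → ℝ≥0∞} (hf : Measurable f) :
    ∫⁻ p, f (exchange j p) = ∫⁻ p, f p := by
  have hm : Measurable fun p : Config N × Space => f (exchange j p) :=
    hf.comp (exchange j).continuous.measurable
  rw [Measure.volume_eq_prod, lintegral_prod _ hm.aemeasurable, lintegral_prod _ hf.aemeasurable]
  refine lintegral_eq_of_lmarginal_eq (μ := fun _ : Fin N => (volume : Measure Space)) {j}
    hm.lintegral_prod_right' hf.lintegral_prod_right' ?_
  rw [lmarginal_singleton, lmarginal_singleton]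
  funext x
  simp only [exchange_apply, update_idem, update_self]
  rw [lintegral_lintegral_swap]
  refine (hf.comp (Measurable.prodMk ?_ measurable_fst)).aemeasurable
  exact (measurable_update x).comp measurable_snd

theorem measurePreserving_exchange (j : Fin N) :
    MeasurePreserving (exchange j) volume volume := by
  refine ⟨(exchange j).continuous.measurable, Measure.ext fun s hs => ?_⟩
  rw [Measure.map_apply (exchange j).continuous.measurable hs, ← lintegral_indicator_one hs,
    ← lintegral_indicator_one ((exchange j).continuous.measurable hs),
    ← lintegral_exchange j (measurable_one.indicator hs)]
  rfl

/-- The unitary operator exchanging the particle `j` with the additional particle. -/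
def exchangeL (j : Fin N) : AugmentedBody N →ₗᵢ[ℂ] AugmentedBody N :=
  Lp.compMeasurePreservingₗᵢ ℂ (exchange j) (measurePreserving_exchange j)

theorem coeFn_exchangeL (j : Fin N) (F : AugmentedBody N) :
    exchangeL j F =ᵐ[volume] fun p => F (exchange j p) :=
  Lp.coeFn_compMeasurePreserving F (measurePreserving_exchange j)

theorem ae_exchange (j : Fin N) {P : Config N × Space → Prop} (h : ∀ᵐ p, P p) :
    ∀ᵐ p, P (exchange j p) := (measurePreserving_exchange j).quasiMeasurePreserving.ae h

theorem exchangeL_exchangeL (j : Fin N) (F : AugmentedBody N) :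
    exchangeL j (exchangeL j F) = F := by
  apply Lp.ext
  filter_upwards [coeFn_exchangeL j (exchangeL j F), ae_exchange j (coeFn_exchangeL j F)]
    with p h1 h2
  rw [h1, h2, exchange_exchange]

theorem inner_exchangeL (j : Fin N) (F G : AugmentedBody N) :
    inner ℂ (exchangeL j F) G = inner ℂ F (exchangeL j G) := by
  rw [← (exchangeL j).inner_map_map, exchangeL_exchangeL]

/-- The `j`-th summand and the Laplacian of the additional particle trade places, while every other
summand is unchanged. -/
theorem augmentedLaplacian_exchange (j : Fin N) (χ : Config N × Space → ℂ)
    (p : Config N × Space) :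
    augmentedLaplacian N (fun q => χ ((exchange j).symm q)) (exchange j p) =
      augmentedLaplacian N χ p := by
  simp only [augmentedLaplacian, totalLaplacian, exchange_symm, exchange_apply, update_idem,
    update_self]
  rw [← Finset.add_sum_erase _ _ (Finset.mem_univ j), ← Finset.add_sum_erase _ _ (Finset.mem_univ j)]
  have h : ∀ k ∈ Finset.univ.erase j,
      Δ (fun y => χ (update (update (update p.1 j p.2) k y) j (p.1 j),
        update (update p.1 j p.2) k y j)) (update p.1 j p.2 k) =
      Δ (fun y => χ (update p.1 k y, p.2)) (p.1 k) := by
    intro k hk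
    have hk' : k ≠ j := Finset.ne_of_mem_erase hk
    have hf : (fun y => χ (update (update (update p.1 j p.2) k y) j (p.1 j),
        update (update p.1 j p.2) k y j)) = fun y => χ (update p.1 k y, p.2) := by
      funext y
      rw [update_comm hk', update_idem, update_of_ne hk'.symm, update_self,
        update_eq_self]
    rw [update_of_ne hk', hf]
  rw [Finset.sum_congr rfl h]
  simp only [update_idem, update_self, update_eq_self]
  ring

theorem HasWeakValue.exchangeL {F G : AugmentedBody N} (h : HasWeakValue (augmentedLaplacian N) F G)
    (j : Fin N) : HasWeakValue (augmentedLaplacian N) (exchangeL j F) (exchangeL j G) := by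
  have hs : ContDiff ℝ ∞ (exchange j).symm := by
    refine ContDiff.prodMk (contDiff_pi.2 fun i => ?_) ?_
    · by_cases hi : i = j
      · subst hi
        simpa using contDiff_snd
      · simp only [ne_eq, hi, not_false_eq_true, update_of_ne]
        exact (contDiff_apply ℝ Space i).comp contDiff_fst
    · exact (contDiff_apply ℝ Space j).comp contDiff_fst
  exact (HasWeakValue.comp_homeomorph h (exchange j) (measurePreserving_exchange j) hs
    fun χ _ p => augmentedLaplacian_exchange j χ p).congr
    (coeFn_exchangeL j F).symm (coeFn_exchangeL j G).symm

theorem inner_exchangeL_im_eq_zero {F G : AugmentedBody N}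
    (h : HasWeakValue (augmentedLaplacian N) F G) (j : Fin N) :
    (inner ℂ (exchangeL j F) G).im = 0 := by
  have h1 := (isTestOperator_augmentedLaplacian N).inner_eq (h.exchangeL j) h
  rw [inner_exchangeL, ← inner_conj_symm] at h1
  exact Complex.conj_eq_iff_im.1 h1

theorem coeFn_proj (j : Fin N) (φ : OneBody) (Ψ : ManyBody N) :
    proj j φ Ψ =ᵐ[volume] projFun j φ Ψ := MemLp.coeFn_toLp (memLp_projFun j φ Ψ)

/-- Integrating out the additional variable `y` of `conj (φ y) Ψ(…, y, …)` produces exactly the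
integral in `p_j`. This turns a `φ`-dependent operator into the fixed unitary `exchangeL j`, through
which time derivatives pass freely. -/
theorem inner_tensor_exchangeL (j : Fin N) (φ : OneBody) (χ Ψ : ManyBody N) :
    inner ℂ (tensor χ φ) (exchangeL j (tensor Ψ φ)) = inner ℂ χ (proj j φ Ψ) := by
  have hi := L2.integrable_inner (𝕜 := ℂ) (tensor χ φ) (exchangeL j (tensor Ψ φ))
  have hae : (fun p => inner ℂ (tensor χ φ p) (exchangeL j (tensor Ψ φ) p)) =ᵐ[volume]
      fun p : Config N × Space => conj (χ p.1) * φ (p.1 j) * (conj (φ p.2) * Ψ (update p.1 j p.2)) := by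
    filter_upwards [coeFn_tensor χ φ, coeFn_exchangeL j (tensor Ψ φ),
      ae_exchange j (coeFn_tensor Ψ φ)] with p h1 h2 h3
    rw [h1, h2, h3, RCLike.inner_apply, exchange_apply, map_mul]
    ring
  rw [L2.inner_def, L2.inner_def, integral_congr_ae hae, Measure.volume_eq_prod,
    integral_prod _ ((integrable_congr hae).1 hi)]
  refine integral_congr_ae ?_
  filter_upwards [coeFn_proj j φ Ψ] with x hx
  rw [hx, integral_const_mul, projFun, RCLike.inner_apply]
  ring

theorem inner_proj (j : Fin N) (φ : OneBody) (χ Ψ : ManyBody N) :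
    inner ℂ (proj j φ χ) Ψ = inner ℂ χ (proj j φ Ψ) := by
  rw [← inner_conj_symm, ← inner_tensor_exchangeL, inner_conj_symm, inner_exchangeL,
    inner_tensor_exchangeL]

end Exchange

/-! ### Algebra of the projections and the counting operator -/

section ProjectionAlgebra

variable {N : ℕ}

theorem ae_lintegral_update_lt_top (j : Fin N) {f : Config N → ℝ≥0∞} (hf : Measurable f)
    (hfi : ∫⁻ x, f x ≠ ⊤) : ∀ᵐ x : Config N, ∫⁻ y, f (update x j y) < ⊤ := by
  obtain ⟨u, hu0, hum, hu1⟩ :=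
    exists_pos_lintegral_lt_of_sigmaFinite (volume : Measure Space) (ε := 1) one_ne_zero
  have key := lintegral_mul_lintegral_update j hum.coe_nnreal_ennreal hf
  have hfin : ∀ᵐ x : Config N, (u (x j) : ℝ≥0∞) * ∫⁻ y, f (update x j y) < ⊤ := by
    refine ae_lt_top ((hum.coe_nnreal_ennreal.comp (measurable_pi_apply j)).mul
      (measurable_lintegral_update j hf)) ?_
    rw [key]
    exact ENNReal.mul_ne_top (hu1.trans ENNReal.one_lt_top).ne hfi
  filter_upwards [hfin] with x hx
  exact ENNReal.lt_top_of_mul_ne_top_right hx.ne (ENNReal.coe_ne_zero.2 (hu0 (x j)).ne')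

/-- After `x_i`, `x_j` are integrated out, the result no longer depends on these coordinates, so its
integral over all of configuration space is useless. A positive integrable weight `u` in each freed
coordinate restores finiteness and is then divided out. -/
theorem ae_lintegral_update_update_lt_top {i j : Fin N} (hij : i ≠ j) {f : Config N → ℝ≥0∞}
    (hf : Measurable f) (hfi : ∫⁻ x, f x ≠ ⊤) :
    ∀ᵐ x : Config N, ∫⁻ y, ∫⁻ z, f (update (update x i y) j z) < ⊤ := by
  obtain ⟨u, hu0, hum, hu1⟩ :=
    exists_pos_lintegral_lt_of_sigmaFinite (volume : Measure Space) (ε := 1) one_ne_zero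
  have key := lintegral_mul_lintegral_update j hum.coe_nnreal_ennreal hf
  have hm : Measurable fun x : Config N => (u (x j) : ℝ≥0∞) * ∫⁻ y, f (update x j y) :=
    (hum.coe_nnreal_ennreal.comp (measurable_pi_apply j)).mul (measurable_lintegral_update j hf)
  have h := ae_lintegral_update_lt_top i hm (by
    rw [key]
    exact ENNReal.mul_ne_top (hu1.trans ENNReal.one_lt_top).ne hfi)
  filter_upwards [h] with x hx
  simp only [update_of_ne hij.symm] at hx
  have hx' : ∫⁻ y, ∫⁻ z, f (update (update x i y) j z) =
    ∫⁻ y, ((fun x => ∫⁻ z, f (update x j z)) ∘ update x i) y := rfl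
  rw [hx']
  replace hx : ∫⁻ y, (u (x j) : ℝ≥0∞) *
    ((fun x => ∫⁻ z, f (update x j z)) ∘ update x i) y < ⊤ := hx
  rw [lintegral_const_mul _ ((measurable_lintegral_update j hf).comp (measurable_update x))] at hx
  exact ENNReal.lt_top_of_mul_ne_top_right hx.ne (ENNReal.coe_ne_zero.2 (hu0 (x j)).ne')

theorem eLpNorm_two_lt_top_iff {Y : Type*} [MeasurableSpace Y] {μ : Measure Y} (f : Y → ℂ) :
    eLpNorm f 2 μ < ⊤ ↔ ∫⁻ x, ‖f x‖ₑ ^ 2 ∂μ < ⊤ := by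
  rw [lintegral_enorm_sq]
  simp

theorem ae_integrable_update_update {i j : Fin N} (hij : i ≠ j) (φ : OneBody) (Ψ : ManyBody N) :
    ∀ᵐ x : Config N, Integrable (fun p : Space × Space =>
      conj (φ p.1) * (conj (φ p.2) * Ψ (update (update x i p.1) j p.2)))
        (volume.prod volume) := by
  have hΨ2 : Measurable fun x => ‖Ψ x‖ₑ ^ 2 :=
    (Lp.stronglyMeasurable Ψ).measurable.enorm.pow_const 2
  have hfin : ∫⁻ x, ‖Ψ x‖ₑ ^ 2 ≠ ⊤ :=
    ((eLpNorm_two_lt_top_iff _).1 (Lp.memLp Ψ).eLpNorm_lt_top).ne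
  filter_upwards [ae_lintegral_update_update_lt_top hij hΨ2 hfin] with x hx
  have hup : Measurable fun p : Space × Space => update (update x i p.1) j p.2 :=
    measurable_update'.comp (((measurable_update x).comp measurable_fst).prodMk measurable_snd)
  have h1 : MemLp (fun p : Space × Space => Ψ (update (update x i p.1) j p.2)) 2
      (volume.prod volume) := by
    refine ⟨((Lp.stronglyMeasurable Ψ).comp_measurable hup).aestronglyMeasurable, ?_⟩
    have h := lintegral_prod (μ := (volume : Measure Space)) (ν := (volume : Measure Space)) _
      (hΨ2.comp hup).aemeasurable
    rw [eLpNorm_two_lt_top_iff]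
    exact h.trans_lt hx
  have h2 : MemLp (fun p : Space × Space => conj (φ p.1) * conj (φ p.2)) 2
      (volume.prod volume) := by
    rw [memLp_two_iff_integrable_sq_norm]
    · simp only [norm_mul, mul_pow, RCLike.norm_conj]
      exact Integrable.mul_prod (Lp.memLp φ).norm.integrable_sq (Lp.memLp φ).norm.integrable_sq
    · have hc : StronglyMeasurable fun y => conj (φ y) :=
        RCLike.continuous_conj.comp_stronglyMeasurable (Lp.stronglyMeasurable φ)
      exact ((hc.comp_measurable measurable_fst).mul
        (hc.comp_measurable measurable_snd)).aestronglyMeasurable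
  have h3 := MemLp.integrable_mul (p := 2) (q := 2) h2 h1
  refine h3.congr (Filter.Eventually.of_forall fun p => ?_)
  simp [mul_assoc]

theorem ae_proj_proj {i j : Fin N} (hij : i ≠ j) (φ : OneBody) (Ψ : ManyBody N) :
    ∀ᵐ x : Config N, proj i φ (proj j φ Ψ) x = φ (x i) * φ (x j) *
      ∫ y, ∫ z, conj (φ y) * (conj (φ z) * Ψ (update (update x i y) j z)) := by
  filter_upwards [coeFn_proj i φ (proj j φ Ψ), ae_ae_update i (coeFn_proj j φ Ψ)] with x hx h1
  rw [hx, projFun, mul_assoc, ← integral_const_mul (φ (x j))]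
  congr 1
  refine integral_congr_ae ?_
  filter_upwards [h1] with y hy
  rw [hy, projFun, update_of_ne hij.symm, integral_const_mul (conj (φ y))]
  ring

/-- For different particles both sides are the same double integral, with the order of integration
exchanged. -/
theorem proj_comm (i j : Fin N) (φ : OneBody) (Ψ : ManyBody N) :
    proj i φ (proj j φ Ψ) = proj j φ (proj i φ Ψ) := by
  by_cases hij : i = j
  · rw [hij]
  apply Lp.ext
  filter_upwards [ae_proj_proj hij φ Ψ, ae_proj_proj (Ne.symm hij) φ Ψ,
    ae_integrable_update_update hij φ Ψ] with x h1 h2 h3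
  rw [h1, h2, integral_integral_swap h3, mul_comm (φ (x i))]
  congr 1
  refine integral_congr_ae (Filter.Eventually.of_forall fun y => ?_)
  refine integral_congr_ae (Filter.Eventually.of_forall fun z => ?_)
  simp only []
  rw [update_comm hij]
  ring

theorem integral_conj_mul_self (φ : OneBody) : ∫ y, conj (φ y) * φ y = ((‖φ‖ ^ 2 : ℝ) : ℂ) := by
  rw [norm_sq_eq_integral, ← integral_complex_ofReal]
  congr 1
  ext y
  rw [mul_comm, Complex.mul_conj, Complex.normSq_eq_norm_sq]

theorem proj_proj (j : Fin N) {φ : OneBody} (hφ : ‖φ‖ = 1) (Ψ : ManyBody N) :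
    proj j φ (proj j φ Ψ) = proj j φ Ψ := by
  apply Lp.ext
  filter_upwards [coeFn_proj j φ (proj j φ Ψ), coeFn_proj j φ Ψ,
    ae_ae_update j (coeFn_proj j φ Ψ)] with x h1 h2 h3
  rw [h1, h2, projFun, projFun]
  congr 1
  have h4 : ∫ y, conj (φ y) * proj j φ Ψ (update x j y) =
      ∫ y, (conj (φ y) * φ y) * ∫ z, conj (φ z) * Ψ (update x j z) := by
    refine integral_congr_ae ?_
    filter_upwards [h3] with y hy
    rw [hy, projFun, update_self, mul_assoc]
    simp only [update_idem]
  rw [h4, integral_mul_const, integral_conj_mul_self, hφ]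
  simp

theorem ae_proj_mul {l : Fin N} {u : Config N → ℂ} (hu : ∀ x y, u (update x l y) = u x)
    (φ : OneBody) {Ψ Φ : ManyBody N} (h : ∀ᵐ x, Φ x = u x * Ψ x) :
    ∀ᵐ x, proj l φ Φ x = u x * proj l φ Ψ x := by
  filter_upwards [coeFn_proj l φ Φ, coeFn_proj l φ Ψ, ae_ae_update l h] with x h1 h2 h3
  rw [h1, h2, projFun, projFun, mul_left_comm, ← integral_const_mul (u x)]
  congr 1
  refine integral_congr_ae ?_
  filter_upwards [h3] with y hy
  rw [hy, hu]
  ring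

theorem inner_proj_eq_of_isSymmetric {Ψ : ManyBody N} (hΨ : IsSymmetric Ψ) (φ : OneBody)
    (i j : Fin N) : inner ℂ Ψ (proj i φ Ψ) = inner ℂ Ψ (proj j φ Ψ) := by
  set σ : Equiv.Perm (Fin N) := Equiv.swap i j
  have hσ := measurePreserving_permHomeomorph σ
  have h1 : ∀ᵐ x, proj i φ Ψ (permHomeomorph σ x) = proj j φ Ψ x := by
    filter_upwards [hσ.quasiMeasurePreserving.ae (coeFn_proj i φ Ψ), coeFn_proj j φ Ψ,
      ae_ae_update j (hΨ σ)] with x h1 h2 h3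
    have hp : permHomeomorph σ x = x ∘ σ := rfl
    rw [h1, h2, projFun, projFun, hp, comp_apply, Equiv.swap_apply_left]
    congr 1
    refine integral_congr_ae ?_
    filter_upwards [h3] with y hy
    rw [← hy, update_comp_equiv]
    simp [σ]
  rw [L2.inner_def, L2.inner_def,
    ← hσ.integral_comp (permHomeomorph σ).measurableEmbedding]
  refine integral_congr_ae ?_
  filter_upwards [h1, hΨ σ] with x h1 h2
  rw [h1]
  congr 1

theorem coproj_apply (j : Fin N) (φ : OneBody) (Ψ : ManyBody N) :
    coproj j φ Ψ = Ψ - proj j φ Ψ := rfl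

theorem norm_coproj_sq (j : Fin N) {φ : OneBody} (hφ : ‖φ‖ = 1) (Ψ : ManyBody N) :
    ((‖coproj j φ Ψ‖ ^ 2 : ℝ) : ℂ) = inner ℂ Ψ (coproj j φ Ψ) := by
  have h := inner_self_eq_norm_sq_to_K (𝕜 := ℂ) (coproj j φ Ψ)
  push_cast
  refine h.symm.trans ?_
  simp only [coproj_apply, inner_sub_left, inner_sub_right, inner_proj, proj_proj j hφ]
  ring

theorem norm_coproj_eq_of_isSymmetric {Ψ : ManyBody N} (hΨ : IsSymmetric Ψ) {φ : OneBody}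
    (hφ : ‖φ‖ = 1) (i j : Fin N) : ‖coproj i φ Ψ‖ ^ 2 = ‖coproj j φ Ψ‖ ^ 2 := by
  have h : ((‖coproj i φ Ψ‖ ^ 2 : ℝ) : ℂ) = ((‖coproj j φ Ψ‖ ^ 2 : ℝ) : ℂ) := by
    rw [norm_coproj_sq i hφ, norm_coproj_sq j hφ, coproj_apply, coproj_apply, inner_sub_right,
      inner_sub_right, inner_proj_eq_of_isSymmetric hΨ φ i j]
  exact_mod_cast h

/-- The product for the set `a` is a joint eigenvector of the idempotents `1 - p i`, with eigenvalue
`1` if `i ∈ a` and `0` otherwise. So multiplying it by `∑ i, (1 - p i)` counts `a`. Summed over all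
`a` the products expand `∏ j, ((1 - p j) + p j) = 1`. -/
theorem sum_card_smul_prod_eq_of_comm {R : Type*} [CommRing R] (p : Fin N → R)
    (hp : ∀ j, p j * p j = p j) :
    ∑ k ∈ Finset.range (N + 1), k • ∑ a ∈ (Finset.univ : Finset (Fin N)).powersetCard k,
      (List.ofFn fun j => if j ∈ a then 1 - p j else p j).prod = ∑ j, (1 - p j) := by
  have h1 : ∀ k ∈ Finset.range (N + 1),
      k • ∑ a ∈ (Finset.univ : Finset (Fin N)).powersetCard k,
        (List.ofFn fun j => if j ∈ a then 1 - p j else p j).prod =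
      ∑ a ∈ (Finset.univ : Finset (Fin N)).powersetCard k,
        ∑ i, (1 - p i) * ∏ j, (if j ∈ a then 1 - p j else p j) := by
    intro k _
    rw [Finset.smul_sum]
    refine Finset.sum_congr rfl fun a ha => ?_
    have h2 : ∀ i, (1 - p i) * ∏ j, (if j ∈ a then 1 - p j else p j) =
        if i ∈ a then ∏ j, (if j ∈ a then 1 - p j else p j) else 0 := by
      intro i
      rw [← Finset.mul_prod_erase _ _ (Finset.mem_univ i)]
      split_ifs
      · linear_combination (hp i) * ∏ x ∈ Finset.univ.erase i, (if x ∈ a then 1 - p x else p x)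
      · linear_combination -(hp i) * ∏ x ∈ Finset.univ.erase i, (if x ∈ a then 1 - p x else p x)
    simp_rw [h2]
    rw [List.prod_ofFn, Finset.sum_ite_mem, Finset.univ_inter, Finset.sum_const,
      (Finset.mem_powersetCard.1 ha).2]
  have h3 : ∑ a ∈ (Finset.univ : Finset (Fin N)).powerset,
      ∏ j, (if j ∈ a then 1 - p j else p j) = 1 := by
    have h := Finset.prod_add (fun j => 1 - p j) p (Finset.univ : Finset (Fin N))
    simp only [sub_add_cancel, Finset.prod_const_one] at h
    refine Eq.trans (Finset.sum_congr rfl fun a _ => ?_) h.symm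
    rw [Finset.prod_ite]
    congr 2
    · ext; simp
    · ext; simp
  have h4 := Finset.sum_powerset (Finset.univ : Finset (Fin N))
    (fun a => ∑ i, (1 - p i) * ∏ j, (if j ∈ a then 1 - p j else p j))
  rw [Finset.card_univ, Fintype.card_fin] at h4
  rw [Finset.sum_congr rfl h1, ← h4, Finset.sum_comm]
  refine Finset.sum_congr rfl fun i _ => ?_
  rw [← Finset.mul_sum, h3, mul_one]

/-- Commuting elements generate a commutative subring, in which the commutative identity applies. -/
theorem sum_card_smul_prod_eq {R : Type*} [Ring R] (p : Fin N → R)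
    (hp : ∀ j, p j * p j = p j) (hc : ∀ i j, p i * p j = p j * p i) :
    ∑ k ∈ Finset.range (N + 1), k • ∑ a ∈ (Finset.univ : Finset (Fin N)).powersetCard k,
      (List.ofFn fun j => if j ∈ a then 1 - p j else p j).prod = ∑ j, (1 - p j) := by
  have : IsMulCommutative (Subring.closure (Set.range p)) :=
    Subring.isMulCommutative_closure (by rintro _ ⟨i, rfl⟩ _ ⟨j, rfl⟩; exact hc i j)
  let : CommRing (Subring.closure (Set.range p)) :=
    { (inferInstance : Ring (Subring.closure (Set.range p))) with
      mul_comm := this.is_comm.comm }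
  let p' : Fin N → Subring.closure (Set.range p) :=
    fun j => ⟨p j, Subring.subset_closure (Set.mem_range_self j)⟩
  have h := sum_card_smul_prod_eq_of_comm p' fun j => Subtype.ext (hp j)
  have h2 := congrArg (Subring.subtype (Subring.closure (Set.range p))) h
  simp only [map_sum, map_nsmul, map_list_prod, List.map_ofFn] at h2
  refine Eq.trans ?_ h2
  refine Finset.sum_congr rfl fun k _ => congrArg _ (Finset.sum_congr rfl fun a _ => ?_)
  congr 2
  funext i
  simp only [comp_apply]
  split_ifs <;> rfl

theorem alpha_eq_sum {φ : OneBody} (hφ : ‖φ‖ = 1) (Ψ : ManyBody N) :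
    alpha N (fun k => (k : ℝ) / N) Ψ φ = (N : ℝ)⁻¹ * ∑ j, ‖coproj j φ Ψ‖ ^ 2 := by
  have h := sum_card_smul_prod_eq (fun j : Fin N => proj j φ)
    (fun j => ContinuousLinearMap.ext fun Ψ => proj_proj j hφ Ψ)
    (fun i j => ContinuousLinearMap.ext fun Ψ => proj_comm i j φ Ψ)
  have h1 : ∑ k ∈ Finset.range (N + 1), (((k : ℝ) / N : ℝ) : ℂ) • countProj N k φ Ψ =
      (N : ℂ)⁻¹ • ∑ j, coproj j φ Ψ := by
    have h2 := congrArg (fun L : ManyBody N →L[ℂ] ManyBody N => (N : ℂ)⁻¹ • L Ψ) h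
    simp only [sum_apply, Finset.smul_sum] at h2
    rw [Finset.smul_sum]
    refine Eq.trans ?_ h2
    refine Finset.sum_congr rfl fun k _ => ?_
    simp only [countProj, sum_apply, Finset.smul_sum]
    refine Finset.sum_congr rfl fun a _ => ?_
    rw [smul_apply, ← Nat.cast_smul_eq_nsmul ℂ, smul_smul]
    congr 1
    push_cast
    ring
  rw [alpha, h1, inner_smul_right, inner_sum]
  simp_rw [← norm_coproj_sq _ hφ]
  rw [← Complex.ofReal_sum, ← Complex.ofReal_natCast, ← Complex.ofReal_inv, ← Complex.ofReal_mul]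
  exact Complex.ofReal_re _

theorem alpha_eq (hN : 1 ≤ N) {φ : OneBody} (hφ : ‖φ‖ = 1) {Ψ : ManyBody N}
    (hΨ : IsSymmetric Ψ) (j : Fin N) :
    alpha N (fun k => (k : ℝ) / N) Ψ φ = ‖coproj j φ Ψ‖ ^ 2 := by
  have hN' : (N : ℝ) ≠ 0 := by positivity
  rw [alpha_eq_sum hφ, Finset.sum_congr rfl fun i _ => norm_coproj_eq_of_isSymmetric hΨ hφ i j]
  simp [hN']

end ProjectionAlgebra

/-! ### Abstract estimate of the fluctuation by near orthogonality -/

section HilbertEstimate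

variable {H : Type*} [NormedAddCommGroup H] [InnerProductSpace ℂ H]

theorem norm_sq_sum_le_of_inner_le {ι : Type*} [DecidableEq ι] (S : Finset ι) (Y : ι → H)
    {c b n : ℝ} (hn : (S.card : ℝ) ≤ n) (hY : ∀ k ∈ S, ‖Y k‖ ≤ c)
    (hYY : ∀ k ∈ S, ∀ l ∈ S, k ≠ l → ‖inner ℂ (Y k) (Y l)‖ ≤ (c * b) ^ 2) :
    ‖∑ k ∈ S, Y k‖ ^ 2 ≤ c ^ 2 * (n + n ^ 2 * b ^ 2) := by
  have h1 : ‖∑ k ∈ S, Y k‖ ^ 2 = ‖∑ k ∈ S, ∑ l ∈ S, inner ℂ (Y k) (Y l)‖ := by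
    simp_rw [← inner_sum, ← sum_inner]
    rw [inner_self_eq_norm_sq_to_K]
    simp
  have h2 : ∀ k ∈ S, ∀ l ∈ S,
      ‖inner ℂ (Y k) (Y l)‖ ≤ (if k = l then c ^ 2 else 0) + (c * b) ^ 2 := by
    intro k hk l hl
    split_ifs with h
    · subst h
      have := norm_inner_le_norm (𝕜 := ℂ) (Y k) (Y k)
      have h3 : ‖Y k‖ * ‖Y k‖ ≤ c ^ 2 := by nlinarith [hY k hk, norm_nonneg (Y k)]
      nlinarith [sq_nonneg (c * b)]
    · simpa using hYY k hk l hl h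
  calc ‖∑ k ∈ S, Y k‖ ^ 2 ≤ ∑ k ∈ S, ∑ l ∈ S, ‖inner ℂ (Y k) (Y l)‖ := by
        rw [h1]
        exact (norm_sum_le _ _).trans (Finset.sum_le_sum fun k _ => norm_sum_le _ _)
    _ ≤ ∑ k ∈ S, ∑ l ∈ S, ((if k = l then c ^ 2 else 0) + (c * b) ^ 2) :=
        Finset.sum_le_sum fun k hk => Finset.sum_le_sum fun l hl => h2 k hk l hl
    _ = S.card * c ^ 2 + S.card ^ 2 * (c * b) ^ 2 := by
        simp only [Finset.sum_add_distrib, Finset.sum_ite_eq, Finset.sum_const, nsmul_eq_mul,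
          Finset.sum_ite_mem, Finset.inter_self]
        ring
    _ ≤ n * c ^ 2 + n ^ 2 * (c * b) ^ 2 := by gcongr
    _ = c ^ 2 * (n + n ^ 2 * b ^ 2) := by ring

/-- Split `Ψ = q_k Ψ + p_k Ψ` in each `Z k Ψ`. The first parts have norm at most `2 K b` each, so
the triangle inequality suffices. The second parts are of order one individually and need the near
orthogonality that `hZ_zero` supplies: only then does their sum gain the factor `√(b² + 1/N)`. -/
theorem norm_inner_sum_interaction_le {N : ℕ} (hN : 1 ≤ N) (j : Fin N) (p : Fin N → H →L[ℂ] H)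
    (Z : Fin N → H →L[ℂ] H) (W : H →L[ℂ] H) {K b : ℝ} (hK : 0 ≤ K) {Ψ : H} (hΨ : ‖Ψ‖ = 1)
    (hp_symm : ∀ k x y, inner ℂ (p k x) y = inner ℂ x (p k y))
    (hp_comm : ∀ k l x, p k (p l x) = p l (p k x)) (hp_norm : ∀ k x, ‖p k x‖ ≤ ‖x‖)
    (hZ_norm : ∀ k ∈ Finset.univ.erase j, ∀ x, ‖Z k x‖ ≤ 2 * K * ‖x‖)
    (hW_norm : ∀ x, ‖W x‖ ≤ K * ‖x‖)
    (hZ_zero : ∀ k ∈ Finset.univ.erase j, ∀ x, p k (Z k (p k x)) = 0)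
    (hZ_comm : ∀ k ∈ Finset.univ.erase j, ∀ l ∈ Finset.univ.erase j, l ≠ k →
      ∀ x, p l (Z k x) = Z k (p l x))
    (hb : ∀ k, ‖Ψ - p k Ψ‖ = b) :
    ‖inner ℂ (Ψ - p j Ψ) ((N : ℂ)⁻¹ • (∑ k ∈ Finset.univ.erase j, Z k Ψ - W Ψ))‖ ≤
      K * (5 * b ^ 2 + 5 * (N : ℝ)⁻¹) := by
  have hN0 : (0 : ℝ) < N := by positivity
  have hb0 : 0 ≤ b := hb j ▸ norm_nonneg _
  set S := Finset.univ.erase j with hS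
  have hcard : (S.card : ℝ) ≤ N := by
    rw [hS]
    exact_mod_cast (Finset.card_le_univ _).trans_eq (Fintype.card_fin N)
  set Y : Fin N → H := fun k => Z k (p k Ψ) with hY
  have hq : ∀ k ∈ S, ∀ x, inner ℂ x (Y k) = inner ℂ (x - p k x) (Y k) := fun k hk x => by
    rw [inner_sub_left, hp_symm, hZ_zero k hk, inner_zero_right, sub_zero]
  have hqY : ∀ k ∈ S, ∀ l ∈ S, l ≠ k → Y k - p l (Y k) = Z k (p k (Ψ - p l Ψ)) := by
    intro k hk l hl hlk
    simp only [hY]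
    rw [hZ_comm k hk l hl hlk, hp_comm, ← map_sub, ← map_sub]
  have hYn : ∀ k ∈ S, ‖Y k‖ ≤ 2 * K := fun k hk => by
    refine (hZ_norm k hk _).trans ?_
    have := hp_norm k Ψ
    rw [hΨ] at this
    nlinarith
  have hqYn : ∀ k ∈ S, ∀ l ∈ S, l ≠ k → ‖Y k - p l (Y k)‖ ≤ 2 * K * b := by
    intro k hk l hl hlk
    rw [hqY k hk l hl hlk]
    refine (hZ_norm k hk _).trans ?_
    have := hp_norm k (Ψ - p l Ψ)
    rw [hb l] at this
    nlinarith
  have hYY : ∀ k ∈ S, ∀ l ∈ S, k ≠ l → ‖inner ℂ (Y k) (Y l)‖ ≤ (2 * K * b) ^ 2 := by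
    intro k hk l hl hkl
    -- Since `p_l Y_l = 0` and `p_k Y_k = 0`, a `q_l` may be inserted on the left and a `q_k` on the
    -- right. Each falls through the other operator onto `Ψ` and yields a factor `b`.
    have h : inner ℂ (Y k) (Y l) = inner ℂ (Y k - p l (Y k)) (Y l - p k (Y l)) := by
      have h1 : p k (p l (Y k)) = 0 := by rw [hp_comm, hZ_zero k hk, map_zero]
      rw [hq l hl, inner_sub_right _ _ (p k (Y l)), ← hp_symm, map_sub, hZ_zero k hk, h1,
        sub_zero, inner_zero_left, sub_zero]
    rw [h]
    refine (norm_inner_le_norm _ _).trans ?_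
    rw [sq]
    exact mul_le_mul (hqYn k hk l hl hkl.symm) (hqYn l hl k hk hkl) (norm_nonneg _) (by positivity)
  have h1 := norm_sq_sum_le_of_inner_le S Y hcard hYn hYY
  set t := Real.sqrt (b ^ 2 + (N : ℝ)⁻¹) with ht
  have ht2 : t ^ 2 = b ^ 2 + (N : ℝ)⁻¹ := Real.sq_sqrt (by positivity)
  have ht0 : 0 ≤ t := Real.sqrt_nonneg _
  have h2 : ‖∑ k ∈ S, Y k‖ ≤ 2 * K * N * t := by
    refine abs_le_of_sq_le_sq' ?_ (by positivity) |>.2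
    refine h1.trans (le_of_eq ?_)
    rw [mul_pow (2 * K * N), ht2]
    field_simp
    ring
  have h3 : ‖∑ k ∈ S, Z k (Ψ - p k Ψ)‖ ≤ N * (2 * K * b) := by
    refine (norm_sum_le _ _).trans ?_
    refine (Finset.sum_le_card_nsmul S _ (2 * K * b) fun k hk => ?_).trans ?_
    · simpa only [hb k] using hZ_norm k hk (Ψ - p k Ψ)
    · rw [nsmul_eq_mul]
      gcongr
  have h4 : ‖W Ψ‖ ≤ K := by simpa [hΨ] using hW_norm Ψ
  have h5 : ∑ k ∈ S, Z k Ψ - W Ψ = ∑ k ∈ S, Z k (Ψ - p k Ψ) + ∑ k ∈ S, Y k - W Ψ := by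
    rw [← Finset.sum_add_distrib]
    congr 1
    refine Finset.sum_congr rfl fun k _ => ?_
    simp [hY]
  have h6 : ‖∑ k ∈ S, Z k Ψ - W Ψ‖ ≤ N * (2 * K * b) + 2 * K * N * t + K := by
    rw [h5]
    exact (norm_sub_le _ _).trans (add_le_add ((norm_add_le _ _).trans (add_le_add h3 h2)) h4)
  refine (norm_inner_le_norm _ _).trans ?_
  rw [hb, norm_smul, norm_inv, Complex.norm_natCast]
  calc b * ((N : ℝ)⁻¹ * ‖∑ k ∈ S, Z k Ψ - W Ψ‖)
      ≤ b * ((N : ℝ)⁻¹ * (N * (2 * K * b) + 2 * K * N * t + K)) := by gcongr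
    _ = K * (2 * b ^ 2 + 2 * (b * t) + b * (N : ℝ)⁻¹) := by field_simp
    _ ≤ K * (5 * b ^ 2 + 5 * (N : ℝ)⁻¹) := by
      refine mul_le_mul_of_nonneg_left ?_ hK
      -- The three bounds add up to `5 b² + 2/N`. The coefficient of `1/N` is relaxed to `5` so that
      -- the result is a multiple of `b² + 1/N`.
      have h7 : 2 * (b * t) ≤ b ^ 2 + t ^ 2 := by nlinarith [sq_nonneg (b - t)]
      have h8 : (N : ℝ)⁻¹ ≤ 1 := inv_le_one_of_one_le₀ (by exact_mod_cast hN)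
      have h9 : (0 : ℝ) < (N : ℝ)⁻¹ := by positivity
      have h10 : b * (N : ℝ)⁻¹ ≤ (N : ℝ)⁻¹ + b ^ 2 := by
        nlinarith [sq_nonneg (b - 1), mul_nonneg (sq_nonneg b) (sub_nonneg.2 h8)]
      nlinarith

end HilbertEstimate

/-! ### Hölder bounds for the interaction and the mean field -/

section InteractionEstimates

theorem _root_.ENNReal.HolderConjugate.holderTriple_two {r s : ℝ≥0∞}
    (h : ENNReal.HolderConjugate r s) : ENNReal.HolderTriple (2 * r) (2 * s) 2 where
  inv_add_inv_eq_inv := by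
    have h1 := h.inv_add_inv_eq_inv
    rw [inv_one] at h1
    rw [ENNReal.mul_inv (by simp) (by simp), ENNReal.mul_inv (by simp) (by simp), ← mul_add, h1,
      mul_one]

/-- The mean field `v ⋆ |φ|²`. -/
def meanField (v : Space → ℝ) (φ : OneBody) (x : Space) : ℝ :=
  (v ⋆[ContinuousLinearMap.mul ℝ ℝ, volume] fun y => ‖φ y‖ ^ 2) x

theorem meanField_eq (v : Space → ℝ) (φ : OneBody) (x : Space) :
    meanField v φ x = ∫ y, v (x - y) * ‖φ y‖ ^ 2 := by
  rw [meanField, convolution, ← integral_sub_left_eq_self _ volume x]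
  simp

theorem hartreePotential_eq (v A : Space → ℝ) (φ : OneBody) (x : Space) :
    hartreePotential v A φ x = A x + meanField v φ x := rfl

theorem measurable_meanField {v : Space → ℝ} (hv : StronglyMeasurable v) (φ : OneBody) :
    Measurable (meanField v φ) := by
  have h : meanField v φ = fun x => ∫ y, v (x - y) * ‖φ y‖ ^ 2 := funext (meanField_eq v φ)
  rw [h]
  refine StronglyMeasurable.measurable (StronglyMeasurable.integral_prod_right'
    (f := fun p : Space × Space => v (p.1 - p.2) * ‖φ p.2‖ ^ 2) ?_)
  exact (hv.comp_measurable (measurable_fst.sub measurable_snd)).mul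
    (((Lp.stronglyMeasurable φ).comp_measurable measurable_snd).norm.pow 2)

variable {r s : ℝ≥0∞} {v : Space → ℝ} {φ : OneBody}

/-- Hölder with `1/(2r) + 1/(2s) = 1/2`; the norm of `v` is unaffected by reflection and
translation. -/
theorem eLpNorm_translate_mul_le (hrs : ENNReal.HolderConjugate r s) (hv : StronglyMeasurable v)
    (φ : OneBody) (x : Space) :
    eLpNorm (fun y => (v (x - y) : ℂ) * φ y) 2 volume ≤
      eLpNorm v (2 * r) volume * eLpNorm φ (2 * s) volume := by
  have := hrs.holderTriple_two
  have hm := Measure.measurePreserving_sub_left (volume : Measure Space) x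
  have h := eLpNorm_smul_le_mul_eLpNorm (p := 2 * r) (q := 2 * s) (r := 2)
    (μ := (volume : Measure Space))
    (Lp.stronglyMeasurable φ).aestronglyMeasurable
    (hv.comp_measurable hm.measurable).aestronglyMeasurable
  rw [eLpNorm_comp_measurePreserving hv.aestronglyMeasurable hm] at h
  refine le_trans (le_of_eq ?_) h
  congr 1

theorem memLp_translate_mul (hrs : ENNReal.HolderConjugate r s) (hv : StronglyMeasurable v)
    (hv' : MemLp v (2 * r) volume) (hφ : MemLp φ (2 * s) volume) (x : Space) :
    MemLp (fun y => (v (x - y) : ℂ) * φ y) 2 volume := by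
  refine ⟨?_, (eLpNorm_translate_mul_le hrs hv φ x).trans_lt
    (ENNReal.mul_lt_top hv'.eLpNorm_lt_top hφ.eLpNorm_lt_top)⟩
  exact ((Complex.measurable_ofReal.comp (hv.measurable.comp
    (measurable_const.sub measurable_id))).mul
    (Lp.stronglyMeasurable φ).measurable).aestronglyMeasurable

theorem integrable_translate_mul (hrs : ENNReal.HolderConjugate r s) (hv : StronglyMeasurable v)
    (hv' : MemLp v (2 * r) volume) (hφ : MemLp φ (2 * s) volume) (x : Space) :
    Integrable (fun y => v (x - y) * ‖φ y‖ ^ 2) volume := by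
  have h := MemLp.integrable_mul (p := 2) (q := 2) (memLp_translate_mul hrs hv hv' hφ x)
    (Lp.memLp φ).star
  refine h.re.congr (Filter.Eventually.of_forall fun y => ?_)
  have h1 : (v (x - y) : ℂ) * φ y * star (φ y) = ((v (x - y) * ‖φ y‖ ^ 2 : ℝ) : ℂ) := by
    rw [mul_assoc, RCLike.star_def, Complex.mul_conj, Complex.normSq_eq_norm_sq]
    push_cast
    rfl
  simp only [Pi.mul_apply, Pi.star_apply, h1]
  exact Complex.ofReal_re _

/-- Cauchy–Schwarz, splitting `v |φ|²` as `(v φ) · |φ|`. So the mean field is bounded although `v`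
need not be. -/
theorem enorm_meanField_le (hrs : ENNReal.HolderConjugate r s) (hv : StronglyMeasurable v)
    (hφ1 : ‖φ‖ = 1) (x : Space) :
    ‖meanField v φ x‖ₑ ≤ eLpNorm v (2 * r) volume * eLpNorm φ (2 * s) volume := by
  have hφ2 : eLpNorm φ 2 volume = 1 := by
    rw [Lp.norm_def, ENNReal.toReal_eq_one_iff] at hφ1
    exact hφ1
  have hm : AEStronglyMeasurable (fun y => (v (x - y) : ℂ) * φ y) volume :=
    ((Complex.measurable_ofReal.comp (hv.measurable.comp
      (measurable_const.sub measurable_id))).mul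
      (Lp.stronglyMeasurable φ).measurable).aestronglyMeasurable
  have h := eLpNorm_smul_le_mul_eLpNorm (p := 2) (q := 2) (r := 1)
    (Lp.stronglyMeasurable φ).aestronglyMeasurable hm
  rw [hφ2, mul_one, eLpNorm_one_eq_lintegral_enorm] at h
  rw [meanField_eq]
  refine (enorm_integral_le_lintegral_enorm _).trans (le_trans (le_of_eq ?_)
    (h.trans (eLpNorm_translate_mul_le hrs hv φ x)))
  refine lintegral_congr fun y => ?_
  simp only [Pi.smul_apply', smul_eq_mul, enorm_mul, enorm_norm, sq, mul_assoc]
  congr 1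
  rw [← ofReal_norm, ← ofReal_norm, Complex.norm_real]

theorem eLpNorm_meanField_mul_le (hrs : ENNReal.HolderConjugate r s) (hv : StronglyMeasurable v)
    (hφ1 : ‖φ‖ = 1) :
    eLpNorm (fun y => (meanField v φ y : ℂ) * φ y) 2 volume ≤
      eLpNorm v (2 * r) volume * eLpNorm φ (2 * s) volume := by
  have hφ2 : eLpNorm φ 2 volume = 1 := by
    rw [Lp.norm_def, ENNReal.toReal_eq_one_iff] at hφ1
    exact hφ1
  rw [← ENNReal.pow_le_pow_left_iff two_ne_zero, ← lintegral_enorm_sq]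
  calc ∫⁻ y, ‖(meanField v φ y : ℂ) * φ y‖ₑ ^ 2
      ≤ ∫⁻ y, (eLpNorm v (2 * r) volume * eLpNorm φ (2 * s) volume) ^ 2 * ‖φ y‖ₑ ^ 2 := by
        refine lintegral_mono fun y => ?_
        rw [enorm_mul, mul_pow]
        gcongr
        rw [← ofReal_norm, Complex.norm_real, ofReal_norm]
        exact enorm_meanField_le hrs hv hφ1 y
    _ = _ := by
        rw [lintegral_const_mul _ ((Lp.stronglyMeasurable φ).measurable.enorm.pow_const 2),
          lintegral_enorm_sq, hφ2, one_pow, mul_one]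

end InteractionEstimates

/-! ### Unbounded multiplication operators composed with a projection -/

section MultiplicationOperators

variable {N : ℕ}

theorem lintegral_mul_lintegral_update_le (j : Fin N) {u f : Config N → ℝ≥0∞} (hu : Measurable u)
    (hf : Measurable f) {c : ℝ≥0∞} (hc : ∀ x, ∫⁻ y, u (update x j y) ≤ c) :
    ∫⁻ x : Config N, u x * ∫⁻ y, f (update x j y) ≤ c * ∫⁻ x, f x := by
  rw [← lintegral_const_mul _ hf]
  refine lintegral_le_of_lmarginal_le (μ := fun _ : Fin N => (volume : Measure Space)) {j}
    (hu.mul (measurable_lintegral_update j hf)) (hf.const_mul _) ?_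
  rw [lmarginal_singleton, lmarginal_singleton]
  intro x
  simp only [update_idem]
  have hx : Measurable fun y => f (update x j y) := hf.comp (measurable_update x)
  have hx' : Measurable fun y => u (update x j y) := hu.comp (measurable_update x)
  rw [lintegral_mul_const _ hx', lintegral_const_mul _ hx]
  gcongr
  exact hc x

theorem measurable_mul_wave {z : Config N → ℝ} (hz : Measurable z) (φ : OneBody) (j : Fin N) :
    Measurable fun x : Config N => ‖(z x : ℂ) * φ (x j)‖ₑ ^ 2 :=
  ((Complex.measurable_ofReal.comp hz).mul ((Lp.stronglyMeasurable φ).measurable.comp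
    (measurable_pi_apply j))).enorm.pow_const 2

theorem lintegral_mul_wave_le {z : Config N → ℝ} (hz : Measurable z) (φ : OneBody) (j : Fin N)
    {c : ℝ≥0∞} (hc : ∀ x, eLpNorm (fun y => (z (update x j y) : ℂ) * φ y) 2 volume ≤ c)
    (Ψ : ManyBody N) :
    ∫⁻ x : Config N, ‖(z x : ℂ) * φ (x j)‖ₑ ^ 2 * ∫⁻ y, ‖Ψ (update x j y)‖ₑ ^ 2 ≤
      (c * eLpNorm Ψ 2 volume) ^ 2 := by
  refine (lintegral_mul_lintegral_update_le j (measurable_mul_wave hz φ j)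
    ((Lp.stronglyMeasurable Ψ).measurable.enorm.pow_const 2) (c := c ^ 2) fun x => ?_).trans ?_
  · simp only [update_self]
    rw [lintegral_enorm_sq]
    exact pow_le_pow_left' (hc x) 2
  · rw [lintegral_enorm_sq, mul_pow]

theorem eLpNorm_mul_proj_le {z : Config N → ℝ} (hz : Measurable z) {φ : OneBody} (hφ : ‖φ‖ = 1)
    (j : Fin N) {c : ℝ≥0∞}
    (hc : ∀ x, eLpNorm (fun y => (z (update x j y) : ℂ) * φ y) 2 volume ≤ c) (Ψ : ManyBody N) :
    eLpNorm (fun x => (z x : ℂ) * proj j φ Ψ x) 2 volume ≤ c * eLpNorm Ψ 2 volume := by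
  have hφ2 : eLpNorm φ 2 volume = 1 := by
    rw [Lp.norm_def, ENNReal.toReal_eq_one_iff] at hφ
    exact hφ
  rw [← ENNReal.pow_le_pow_left_iff two_ne_zero, ← lintegral_enorm_sq]
  refine le_trans (lintegral_mono_ae ?_) (lintegral_mul_wave_le hz φ j hc Ψ)
  filter_upwards [coeFn_proj j φ Ψ] with x hx
  rw [hx, enorm_mul, mul_pow]
  refine (mul_le_mul_right (enorm_projFun_sq_le j (Lp.stronglyMeasurable φ)
    (Lp.stronglyMeasurable Ψ) x) _).trans (le_of_eq ?_)
  rw [lintegral_enorm_sq φ, hφ2, enorm_mul]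
  ring

/-- The function `p_j Ψ` is `φ(x_j)` times a function that does not depend on `x_j`. Hence only the
`L²` norm of `z φ` in the variable `x_j`, uniformly in the other variables, controls `z p_j`, and
`z` itself may be unbounded. -/
theorem exists_mul_proj {z : Config N → ℝ} (hz : Measurable z) {φ : OneBody} (hφ : ‖φ‖ = 1)
    (j : Fin N) {c : ℝ≥0∞} (hc' : c ≠ ⊤)
    (hc : ∀ x, eLpNorm (fun y => (z (update x j y) : ℂ) * φ y) 2 volume ≤ c) :
    ∃ L : ManyBody N →L[ℂ] ManyBody N, (∀ Ψ, ∀ᵐ x, L Ψ x = (z x : ℂ) * proj j φ Ψ x) ∧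
      ∀ Ψ, ‖L Ψ‖ ≤ c.toReal * ‖Ψ‖ := by
  have hL : ∀ Ψ : ManyBody N, MemLp (fun x => (z x : ℂ) * proj j φ Ψ x) 2 volume := fun Ψ =>
    ⟨((Complex.measurable_ofReal.comp hz).mul
      (Lp.stronglyMeasurable (proj j φ Ψ)).measurable).aestronglyMeasurable,
      (eLpNorm_mul_proj_le hz hφ j hc Ψ).trans_lt
        (ENNReal.mul_lt_top hc'.lt_top (Lp.memLp Ψ).eLpNorm_lt_top)⟩
  have hbound : ∀ Ψ, ‖(hL Ψ).toLp‖ ≤ c.toReal * ‖Ψ‖ := fun Ψ => by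
    rw [Lp.norm_toLp, Lp.norm_def, ← ENNReal.toReal_mul]
    exact ENNReal.toReal_mono (ENNReal.mul_ne_top hc' (Lp.memLp Ψ).eLpNorm_ne_top)
      (eLpNorm_mul_proj_le hz hφ j hc Ψ)
  refine ⟨LinearMap.mkContinuous
    { toFun := fun Ψ => (hL Ψ).toLp
      map_add' := fun Ψ Ψ' => by
        rw [← MemLp.toLp_add, MemLp.toLp_eq_toLp_iff, map_add]
        filter_upwards [Lp.coeFn_add (proj j φ Ψ) (proj j φ Ψ')] with x hx
        rw [hx, Pi.add_apply, Pi.add_apply, mul_add]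
      map_smul' := fun a Ψ => by
        rw [RingHom.id_apply, ← MemLp.toLp_const_smul, MemLp.toLp_eq_toLp_iff, map_smul]
        filter_upwards [Lp.coeFn_smul a (proj j φ Ψ)] with x hx
        rw [hx, Pi.smul_apply, Pi.smul_apply, mul_smul_comm] } c.toReal hbound,
    fun Ψ => (hL Ψ).coeFn_toLp, hbound⟩

theorem memLp_mul_exchange {z : Config N → ℝ} (hz : Measurable z) (φ : OneBody)
    (j : Fin N) {c : ℝ≥0∞} (hc' : c ≠ ⊤)
    (hc : ∀ x, eLpNorm (fun y => (z (update x j y) : ℂ) * φ y) 2 volume ≤ c) (Ψ : ManyBody N) :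
    MemLp (fun p : Config N × Space => (z p.1 : ℂ) * φ (p.1 j) * Ψ (update p.1 j p.2)) 2 volume := by
  have hm : Measurable fun p : Config N × Space =>
      (z p.1 : ℂ) * φ (p.1 j) * Ψ (update p.1 j p.2) :=
    (((Complex.measurable_ofReal.comp hz).mul ((Lp.stronglyMeasurable φ).measurable.comp
      (measurable_pi_apply j))).comp measurable_fst).mul
      ((Lp.stronglyMeasurable Ψ).measurable.comp measurable_update')
  refine ⟨hm.aestronglyMeasurable, (eLpNorm_two_lt_top_iff _).2 ?_⟩
  have h2 : Measurable fun x => ‖Ψ x‖ₑ ^ 2 :=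
    (Lp.stronglyMeasurable Ψ).measurable.enorm.pow_const 2
  rw [Measure.volume_eq_prod, lintegral_prod _ (hm.enorm.pow_const 2).aemeasurable]
  refine lt_of_eq_of_lt (lintegral_congr fun x => ?_)
    ((lintegral_mul_wave_le hz φ j hc Ψ).trans_lt
      (ENNReal.pow_lt_top (ENNReal.mul_lt_top hc'.lt_top (Lp.memLp Ψ).eLpNorm_lt_top)))
  refine Eq.trans ?_ (lintegral_const_mul _ (h2.comp (measurable_update x)))
  simp only [enorm_mul, mul_pow]

/-- The operator `p_k z p_k` is `p_k` times the average of `z` against `|φ|²` in `x_k`. This is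
where subtracting the mean field takes effect. -/
theorem proj_mul_proj_eq_zero {k : Fin N} {z : Config N → ℝ} {φ : OneBody}
    (hz : ∀ x : Config N, ∫ y, z (update x k y) * ‖φ y‖ ^ 2 = 0) {Φ χ : ManyBody N}
    (h : ∀ᵐ x, Φ x = (z x : ℂ) * proj k φ χ x) : proj k φ Φ = 0 := by
  apply Lp.ext
  filter_upwards [coeFn_proj k φ Φ, ae_ae_update k (coeFn_proj k φ χ), ae_ae_update k h,
    Lp.coeFn_zero ℂ 2 (volume : Measure (Config N))] with x h1 h2 h3 h4
  rw [h1, h4, projFun, Pi.zero_apply]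
  have h5 : ∫ y, conj (φ y) * Φ (update x k y) =
      ∫ y, ((z (update x k y) * ‖φ y‖ ^ 2 : ℝ) : ℂ) * ∫ w, conj (φ w) * χ (update x k w) := by
    refine integral_congr_ae ?_
    filter_upwards [h2, h3] with y hy hy'
    rw [hy', hy, projFun, update_self, Complex.ofReal_mul, Complex.ofReal_pow,
      ← Complex.conj_mul']
    simp only [update_idem]
    ring
  rw [h5, integral_mul_const, integral_complex_ofReal, hz]
  simp

end MultiplicationOperators

/-! ### Splitting the potential into an exchange-invariant part and a fluctuation -/

section Potentials

variable {N : ℕ}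

theorem sum_sum_erase_eq {N : ℕ} (u : Fin N → Fin N → ℝ) (hu : ∀ j k, u j k = u k j) (j : Fin N) :
    ∑ a, ∑ b ∈ Finset.univ.erase a, u a b = 2 * ∑ k ∈ Finset.univ.erase j, u j k +
      ∑ a ∈ Finset.univ.erase j, ∑ b ∈ (Finset.univ.erase a).erase j, u a b := by
  have h : ∀ a ∈ Finset.univ.erase j, ∑ b ∈ Finset.univ.erase a, u a b =
      u j a + ∑ b ∈ (Finset.univ.erase a).erase j, u a b := fun a ha => by
    rw [← Finset.add_sum_erase _ _
      (Finset.mem_erase.2 ⟨(Finset.ne_of_mem_erase ha).symm, Finset.mem_univ j⟩), hu a j]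
  rw [← Finset.add_sum_erase _ _ (Finset.mem_univ j), Finset.sum_congr rfl h,
    Finset.sum_add_distrib]
  ring

/-- The part of the mean-field Hamiltonian's potential in which the particle `j` does not take
part. -/
def spectatorPotential (v A : Space → ℝ) (j : Fin N) (x : Config N) : ℝ :=
  2⁻¹ * ∑ a ∈ Finset.univ.erase j, ∑ b ∈ (Finset.univ.erase a).erase j, (N : ℝ)⁻¹ * v (x a - x b) +
    ∑ a ∈ Finset.univ.erase j, A (x a)

theorem spectatorPotential_update (v A : Space → ℝ) (j : Fin N) (x : Config N) (y : Space) :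
    spectatorPotential v A j (update x j y) = spectatorPotential v A j x := by
  unfold spectatorPotential
  congr 1
  · congr 1
    refine Finset.sum_congr rfl fun a ha => Finset.sum_congr rfl fun b hb => ?_
    rw [update_of_ne (Finset.ne_of_mem_erase ha), update_of_ne (Finset.ne_of_mem_erase hb)]
  · refine Finset.sum_congr rfl fun a ha => ?_
    rw [update_of_ne (Finset.ne_of_mem_erase ha)]

theorem manyBodyPotential_eq_spectator {v : Space → ℝ} (hv : ∀ x, v (-x) = v x) (A : Space → ℝ)
    (j : Fin N) (x : Config N) : manyBodyPotential N v A x =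
      (N : ℝ)⁻¹ * ∑ k ∈ Finset.univ.erase j, v (x j - x k) + A (x j) +
        spectatorPotential v A j x := by
  rw [manyBodyPotential_eq hv, sum_sum_erase_eq _ _ j, spectatorPotential,
    ← Finset.add_sum_erase _ _ (Finset.mem_univ j)]
  · simp only [← Finset.mul_sum]
    ring
  · intro a b
    rw [← hv (x b - x a), neg_sub]

/-- The difference between the interaction of the particle `j` with the others and the mean
field. -/
def fluctuation (v : Space → ℝ) (φ : OneBody) (j : Fin N) (x : Config N) : ℝ :=
  (N : ℝ)⁻¹ * ∑ k ∈ Finset.univ.erase j, v (x j - x k) - meanField v φ (x j)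

/-- Subtracting the fluctuation replaces the interaction of particle `j` by its mean field. Then
particle `j` and the additional particle both feel `A + v ⋆ |φ|²`, and the rest does not involve
them. -/
theorem exchange_invariant_potential {v : Space → ℝ} (hv : ∀ x, v (-x) = v x) (A : Space → ℝ)
    (φ : OneBody) (j : Fin N) (p : Config N × Space) :
    manyBodyPotential N v A (exchange j p).1 + hartreePotential v A φ (exchange j p).2 -
        fluctuation v φ j (exchange j p).1 =
      manyBodyPotential N v A p.1 + hartreePotential v A φ p.2 - fluctuation v φ j p.1 := by
  simp only [manyBodyPotential_eq_spectator hv A j, hartreePotential_eq, fluctuation,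
    exchange_apply, spectatorPotential_update, update_self]
  ring

/-- There are only `N - 1` partners but the mean field has weight one, so one copy of `N⁻¹ v ⋆
|φ|²(x_j)` is left after centring each pair term. It contributes at order `1/N`. -/
theorem fluctuation_eq (hN : 1 ≤ N) (v : Space → ℝ) (φ : OneBody) (j : Fin N) (x : Config N) :
    fluctuation v φ j x = (N : ℝ)⁻¹ * (∑ k ∈ Finset.univ.erase j,
      (v (x j - x k) - meanField v φ (x j)) - meanField v φ (x j)) := by
  have hN' : (N : ℝ) ≠ 0 := by positivity
  rw [fluctuation, Finset.sum_sub_distrib, Finset.sum_const, Finset.card_erase_of_mem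
    (Finset.mem_univ j), Finset.card_univ, Fintype.card_fin, nsmul_eq_mul, Nat.cast_sub hN]
  field_simp
  push_cast
  ring

end Potentials

/-! ### The time derivative of the overlap -/

section Derivative

variable {N : ℕ}

theorem isHamiltonianValue_tensor {V : Config N → ℝ} {U : Space → ℝ} {Ψ h : ManyBody N}
    {φ k : OneBody} (hΨ : IsHamiltonianValue (totalLaplacian N) V Ψ h)
    (hφ : IsHamiltonianValue (fun χ : Space → ℂ => Δ χ) U φ k) :
    IsHamiltonianValue (augmentedLaplacian N) (fun p => V p.1 + U p.2) (tensor Ψ φ)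
      (tensor h φ + tensor Ψ k) := by
  obtain ⟨g, w, hg, hw, rfl⟩ := hΨ
  obtain ⟨g', w', hg', hw', rfl⟩ := hφ
  refine ⟨tensor g φ + tensor Ψ g', tensor w φ + tensor Ψ w', hasWeakValue_tensor hg hg', ?_, ?_⟩
  · filter_upwards [coeFn_tensor Ψ φ, coeFn_tensor w φ, coeFn_tensor Ψ w', ae_fst hw, ae_snd hw',
      Lp.coeFn_add (tensor w φ) (tensor Ψ w')] with p h1 h2 h3 h4 h5 h6
    rw [h6, Pi.add_apply, h1, h2, h3, h4, h5]
    push_cast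
    ring
  · rw [add_tensor, tensor_add, ← neg_one_smul ℂ g, ← neg_one_smul ℂ g', smul_tensor, tensor_smul]
    module

/-- The remainder `∫ (V - Q) F conj(E_j F)` is mapped to its conjugate by the change of variables
`exchange j`, hence is real. Only the combined integrand is known to be integrable: `V F` and `Q E_j
F` are in `L²`, whereas `V` or `Q` alone need not act on the other function. -/
theorem inner_exchangeL_mul_im {Q : Config N → ℝ} {V : Config N × Space → ℝ} {j : Fin N}
    {Ψ χ : ManyBody N} {φ : OneBody} {w : AugmentedBody N}
    (hV : ∀ p, V (exchange j p) - Q (exchange j p).1 = V p - Q p.1)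
    (hw : ∀ᵐ p, w p = (V p : ℂ) * tensor Ψ φ p)
    (hχ : ∀ᵐ x, χ x = (Q x : ℂ) * proj j φ Ψ x)
    (hQ : MemLp (fun p : Config N × Space => (Q p.1 : ℂ) * φ (p.1 j) * Ψ (update p.1 j p.2)) 2
      volume) :
    (inner ℂ (exchangeL j (tensor Ψ φ)) w).im = (inner ℂ χ Ψ).im := by
  set F := tensor Ψ φ with hF
  set G : AugmentedBody N := hQ.toLp with hG
  have hexp : ∀ᵐ p : Config N × Space,
      exchangeL j F p = Ψ (update p.1 j p.2) * φ (p.1 j) := by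
    filter_upwards [coeFn_exchangeL j F, ae_exchange j (coeFn_tensor Ψ φ)] with p h1 h2
    rw [h1, h2]
    rfl
  have hGF : inner ℂ G F = inner ℂ χ Ψ := by
    have hae : (fun p => inner ℂ (G p) (F p)) =ᵐ[volume] fun p : Config N × Space =>
        ((Q p.1 : ℂ) * conj (φ (p.1 j)) * Ψ p.1) * conj (conj (φ p.2) * Ψ (update p.1 j p.2)) := by
      filter_upwards [hQ.coeFn_toLp, coeFn_tensor Ψ φ] with p h1 h2
      rw [h1, h2, RCLike.inner_apply]
      simp only [map_mul, Complex.conj_ofReal, Complex.conj_conj]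
      ring
    have hi := (integrable_congr hae).1 (L2.integrable_inner (𝕜 := ℂ) G F)
    rw [L2.inner_def, integral_congr_ae hae, Measure.volume_eq_prod, integral_prod _ hi,
      L2.inner_def]
    refine integral_congr_ae ?_
    filter_upwards [hχ, coeFn_proj j φ Ψ] with x h1 h2
    rw [integral_const_mul, integral_conj, h1, h2, projFun, RCLike.inner_apply]
    simp only [map_mul, Complex.conj_ofReal]
    ring
  have hJ : inner ℂ (exchangeL j F) w - inner ℂ G F =
      ∫ p, ((V p - Q p.1 : ℝ) : ℂ) * (F p * conj (exchangeL j F p)) := by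
    rw [L2.inner_def, L2.inner_def, ← integral_sub (L2.integrable_inner _ _)
      (L2.integrable_inner _ _)]
    refine integral_congr_ae ?_
    filter_upwards [hw, hQ.coeFn_toLp, hexp] with p h1 h2 h3
    rw [h1, h2, h3, RCLike.inner_apply, RCLike.inner_apply]
    simp only [map_mul, Complex.conj_ofReal]
    push_cast
    ring
  have hreal : conj (inner ℂ (exchangeL j F) w - inner ℂ G F) =
      inner ℂ (exchangeL j F) w - inner ℂ G F := by
    rw [hJ, ← integral_conj, ← (measurePreserving_exchange j).integral_comp
      (exchange j).measurableEmbedding]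
    refine integral_congr_ae ?_
    filter_upwards [coeFn_exchangeL j F, ae_exchange j (coeFn_exchangeL j F)] with p h1 h2
    rw [h2, exchange_exchange, h1, hV]
    simp only [map_mul, Complex.conj_ofReal, Complex.conj_conj]
    ring
  have h := Complex.conj_eq_iff_im.1 hreal
  rw [Complex.sub_im, hGF, sub_eq_zero] at h
  exact h

theorem norm_coproj_sq_eq_sub (j : Fin N) {φ : OneBody} (hφ : ‖φ‖ = 1) {Ψ : ManyBody N}
    (hΨ : ‖Ψ‖ = 1) : ‖coproj j φ Ψ‖ ^ 2 =
      1 - (inner ℂ (tensor Ψ φ) (exchangeL j (tensor Ψ φ))).re := by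
  have h := congrArg Complex.re (norm_coproj_sq j hφ Ψ)
  rw [Complex.ofReal_re] at h
  rw [h, coproj_apply, inner_sub_right, inner_self_eq_norm_sq_to_K, hΨ, inner_tensor_exchangeL]
  simp

/-- The two terms of the product rule are complex conjugates of each other because `exchangeL j` is
self-adjoint. -/
theorem hasDerivWithinAt_inner_exchangeL {F : ℝ → AugmentedBody N} {F' : AugmentedBody N}
    {s : Set ℝ} {t : ℝ} (hF : HasDerivWithinAt F F' s t) (j : Fin N) :
    HasDerivWithinAt (fun t => 1 - (inner ℂ (F t) (exchangeL j (F t))).re)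
      (-(2 * (inner ℂ (exchangeL j (F t)) F').re)) s t := by
  let L : AugmentedBody N →L[ℝ] AugmentedBody N :=
    (exchangeL j).toContinuousLinearMap.restrictScalars ℝ
  have h1 : HasDerivWithinAt (fun t => exchangeL j (F t)) (exchangeL j F') s t :=
    L.hasFDerivAt.comp_hasDerivWithinAt t hF
  have h2 := Complex.reCLM.hasFDerivAt.comp_hasDerivWithinAt t (hF.inner ℂ h1)
  have h3 : Complex.reCLM (inner ℂ (F t) (exchangeL j F') + inner ℂ F' (exchangeL j (F t))) =
      2 * (inner ℂ (exchangeL j (F t)) F').re := by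
    rw [← inner_exchangeL, ← inner_conj_symm F', map_add, Complex.reCLM_apply,
      Complex.reCLM_apply, Complex.conj_re]
    ring
  rw [h3] at h2
  exact h2.const_sub 1

theorem re_inner_exchangeL_eq {Q : Config N → ℝ} {V : Config N × Space → ℝ} {j : Fin N}
    {Ψ χ : ManyBody N} {φ : OneBody} {F' : AugmentedBody N}
    (hV : ∀ p, V (exchange j p) - Q (exchange j p).1 = V p - Q p.1)
    (hF : IsHamiltonianValue (augmentedLaplacian N) V (tensor Ψ φ) (Complex.I • F'))
    (hχ : ∀ᵐ x, χ x = (Q x : ℂ) * proj j φ Ψ x)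
    (hQ : MemLp (fun p : Config N × Space => (Q p.1 : ℂ) * φ (p.1 j) * Ψ (update p.1 j p.2)) 2
      volume) :
    (inner ℂ (exchangeL j (tensor Ψ φ)) F').re = (inner ℂ χ Ψ).im := by
  obtain ⟨g, w, hg, hw, h⟩ := hF
  have h1 : (inner ℂ (exchangeL j (tensor Ψ φ)) (Complex.I • F')).im = (inner ℂ χ Ψ).im := by
    rw [h, inner_add_right, inner_neg_right, Complex.add_im, Complex.neg_im,
      inner_exchangeL_im_eq_zero hg j, inner_exchangeL_mul_im hV hw hχ hQ, neg_zero, zero_add]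
  rw [inner_smul_right] at h1
  simpa using h1

end Derivative

/-! ### Gronwall with an integrable coefficient -/

section Gronwall

theorem add_le_mul_exp_of_deriv_le {T ε : ℝ} (hε : 0 < ε) {α C : ℝ → ℝ}
    (hα : ∀ t ∈ Set.Icc 0 T, 0 ≤ α t)
    (hd : ∀ t ∈ Set.Icc 0 T, ∃ a : ℝ, HasDerivWithinAt α a (Set.Icc 0 T) t ∧
      a ≤ C t * (α t + ε))
    (hC : IntervalIntegrable C volume 0 T) :
    ∀ t ∈ Set.Icc 0 T, α t ≤ Real.exp (∫ τ in (0 : ℝ)..t, C τ) * α 0 +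
      (Real.exp (∫ τ in (0 : ℝ)..t, C τ) - 1) * ε := by
  intro t ht
  have hT : 0 ≤ T := ht.1.trans ht.2
  have hpos : ∀ s ∈ Set.Icc 0 T, 0 < α s + ε := fun s hs => by linarith [hα s hs]
  choose! a ha1 ha2 using hd
  have hlog : ∀ s ∈ Set.Icc 0 T, HasDerivWithinAt (fun s => Real.log (α s + ε))
      (a s / (α s + ε)) (Set.Icc 0 T) s := fun s hs =>
    ((ha1 s hs).add_const ε).log (hpos s hs).ne'
  have hsub : Set.Icc 0 t ⊆ Set.Icc 0 T := Set.Icc_subset_Icc_right ht.2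
  have hCi : IntegrableOn C (Set.Icc 0 t) :=
    ((intervalIntegrable_iff_integrableOn_Icc_of_le hT).1 hC).mono_set hsub
  -- The logarithmic derivative of `α + ε` is at most `C`. Adding `ε > 0` keeps the logarithm
  -- defined where `α` vanishes, and the inequality needs `C` to be integrable only.
  have key := intervalIntegral.sub_le_integral_of_hasDeriv_right_of_le
    (g := fun s => Real.log (α s + ε)) (g' := fun s => a s / (α s + ε)) ht.1
    (fun s hs => ((hlog s (hsub hs)).continuousWithinAt).mono hsub)
    (fun s hs => ((hlog s (hsub ⟨hs.1.le, hs.2.le⟩)).hasDerivAt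
      (Icc_mem_nhds hs.1 (hs.2.trans_le ht.2))).hasDerivWithinAt) hCi
    (fun s hs => by
      have hs' := hsub ⟨hs.1.le, hs.2.le⟩
      rw [div_le_iff₀ (hpos s hs')]
      exact ha2 s hs')
  have h0 : (0 : ℝ) ∈ Set.Icc 0 T := ⟨le_rfl, hT⟩
  have h1 := Real.exp_le_exp.2 (sub_le_iff_le_add.1 key)
  rw [Real.exp_add, Real.exp_log (hpos t ht), Real.exp_log (hpos 0 h0)] at h1
  linarith

end Gronwall

/-! ### The estimate for a regular even potential -/

section MainEstimate

variable {N : ℕ}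

theorem norm_proj_le {φ : OneBody} (hφ : ‖φ‖ = 1) (j : Fin N) (Ψ : ManyBody N) :
    ‖proj j φ Ψ‖ ≤ ‖Ψ‖ := by
  have h := (proj j φ : ManyBody N →L[ℂ] ManyBody N).le_of_opNorm_le
    (LinearMap.mkContinuous_norm_le _ (by positivity) _ : ‖(proj j φ : ManyBody N →L[ℂ] _)‖ ≤ _) Ψ
  simpa [hφ] using h

theorem abs_im_inner_fluctuation_le (hN : 1 ≤ N) {r s : ℝ≥0∞}
    (hrs : ENNReal.HolderConjugate r s) {v : Space → ℝ} (hv : StronglyMeasurable v)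
    (hv' : MemLp v (2 * r) volume) (hv_even : ∀ x, v (-x) = v x) {φ : OneBody} (hφ1 : ‖φ‖ = 1)
    (hφ : MemLp φ (2 * s) volume) {Ψ : ManyBody N} (hΨ : ‖Ψ‖ = 1) (hΨs : IsSymmetric Ψ)
    (j : Fin N) :
    ∃ χ : ManyBody N, (∀ᵐ x, χ x = (fluctuation v φ j x : ℂ) * proj j φ Ψ x) ∧
      MemLp (fun p : Config N × Space =>
        (fluctuation v φ j p.1 : ℂ) * φ (p.1 j) * Ψ (update p.1 j p.2)) 2 volume ∧
      |(inner ℂ χ Ψ).im| ≤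
        (eLpNorm v (2 * r) volume).toReal * (eLpNorm φ (2 * s) volume).toReal *
          (5 * ‖coproj j φ Ψ‖ ^ 2 + 5 * (N : ℝ)⁻¹) := by
  set c : ℝ≥0∞ := eLpNorm v (2 * r) volume * eLpNorm φ (2 * s) volume with hc
  have hc' : c ≠ ⊤ := ENNReal.mul_ne_top hv'.eLpNorm_ne_top hφ.eLpNorm_ne_top
  have hmf := measurable_meanField hv φ
  let w : Config N → ℝ := fun x => meanField v φ (x j)
  let z : Fin N → Config N → ℝ := fun k x => v (x j - x k) - meanField v φ (x j)
  have hwm : Measurable w := hmf.comp (measurable_pi_apply j)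
  have hzm : ∀ k, Measurable (z k) := fun k =>
    (hv.measurable.comp ((measurable_pi_apply j).sub (measurable_pi_apply k))).sub hwm
  have hwc : ∀ x, eLpNorm (fun y => (w (update x j y) : ℂ) * φ y) 2 volume ≤ c := fun x => by
    simp only [w, update_self]
    exact eLpNorm_meanField_mul_le hrs hv hφ1
  have hflip : ∀ a b : Space, v (a - b) = v (b - a) := fun a b => by
    rw [← hv_even (b - a), neg_sub]
  have hzu : ∀ k ∈ Finset.univ.erase j, ∀ (x : Config N) y,
      z k (update x j y) = v (x k - y) - meanField v φ y := by
    intro k hk x y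
    simp only [z, update_self, update_of_ne (Finset.ne_of_mem_erase hk)]
    rw [hflip]
  have hzc : ∀ k ∈ Finset.univ.erase j, ∀ x,
      eLpNorm (fun y => (z k (update x j y) : ℂ) * φ y) 2 volume ≤ 2 * c := by
    intro k hk x
    simp only [hzu k hk, Complex.ofReal_sub, sub_mul]
    rw [two_mul]
    refine (eLpNorm_sub_le (memLp_translate_mul hrs hv hv' hφ (x k)).aestronglyMeasurable ?_
      (by norm_num)).trans (add_le_add (eLpNorm_translate_mul_le hrs hv φ (x k))
        (eLpNorm_meanField_mul_le hrs hv hφ1))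
    exact ((Complex.measurable_ofReal.comp hmf).mul
      (Lp.stronglyMeasurable φ).measurable).aestronglyMeasurable
  obtain ⟨W, hW1, hW2⟩ := exists_mul_proj hwm hφ1 j hc' hwc
  have hZex : ∀ k, ∃ L : ManyBody N →L[ℂ] ManyBody N, k ∈ Finset.univ.erase j →
      (∀ Ψ, ∀ᵐ x, L Ψ x = (z k x : ℂ) * proj j φ Ψ x) ∧
      ∀ Ψ, ‖L Ψ‖ ≤ (2 * c).toReal * ‖Ψ‖ := fun k => by
    by_cases hk : k ∈ Finset.univ.erase j
    · obtain ⟨L, hL⟩ := exists_mul_proj (hzm k) hφ1 j (ENNReal.mul_ne_top (by simp) hc') (hzc k hk)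
      exact ⟨L, fun _ => hL⟩
    · exact ⟨0, fun h => absurd h hk⟩
  choose Z hZ using hZex
  set χ : ManyBody N := (N : ℂ)⁻¹ • (∑ k ∈ Finset.univ.erase j, Z k Ψ - W Ψ) with hχ
  have hχae : ∀ᵐ x, χ x = (fluctuation v φ j x : ℂ) * proj j φ Ψ x := by
    have hsum : ∀ᵐ x, (∑ k ∈ Finset.univ.erase j, Z k Ψ : ManyBody N) x =
        ∑ k ∈ Finset.univ.erase j, Z k Ψ x := by
      have := Lp.coeFn_finsetSum (Finset.univ.erase j) (fun k => Z k Ψ)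
      filter_upwards [this] with x hx
      simpa using hx
    have hall : ∀ᵐ x, ∀ k ∈ Finset.univ.erase j, Z k Ψ x = (z k x : ℂ) * proj j φ Ψ x := by
      rw [Finset.eventually_all]
      exact fun k hk => (hZ k hk).1 Ψ
    filter_upwards [hsum, hall, hW1 Ψ, Lp.coeFn_smul (N : ℂ)⁻¹
      (∑ k ∈ Finset.univ.erase j, Z k Ψ - W Ψ), Lp.coeFn_sub (∑ k ∈ Finset.univ.erase j, Z k Ψ)
      (W Ψ)] with x h1 h2 h3 h4 h5
    rw [hχ, h4, Pi.smul_apply, h5, Pi.sub_apply, h1, h3, Finset.sum_congr rfl h2,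
      fluctuation_eq hN, ← Finset.sum_mul]
    simp only [z, w, smul_eq_mul]
    push_cast
    ring
  have hmem : MemLp (fun p : Config N × Space =>
      (fluctuation v φ j p.1 : ℂ) * φ (p.1 j) * Ψ (update p.1 j p.2)) 2 volume := by
    have h1 := memLp_mul_exchange hwm φ j hc' hwc Ψ
    have h2 := memLp_finsetSum (Finset.univ.erase j) fun k hk =>
      memLp_mul_exchange (hzm k) φ j (ENNReal.mul_ne_top (by simp) hc') (hzc k hk) Ψ
    have h3 := (h2.sub h1).const_mul (N : ℂ)⁻¹
    refine h3.ae_eq (Filter.Eventually.of_forall fun p => ?_)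
    simp only [Pi.sub_apply, fluctuation_eq hN, z, w]
    rw [← Finset.sum_mul, ← Finset.sum_mul]
    push_cast
    ring
  refine ⟨χ, hχae, hmem, ?_⟩
  -- The vector `χ` is a real multiplier times `p_j Ψ`, so pairing it with `p_j Ψ` gives a real
  -- number. Thus `Ψ` may be replaced by `q_j Ψ`, which supplies the first small factor.
  have hreal : (inner ℂ (proj j φ Ψ) χ).im = 0 := inner_mul_real_im_eq_zero hχae
  have him : |(inner ℂ χ Ψ).im| = |(inner ℂ (Ψ - proj j φ Ψ) χ).im| := by
    rw [inner_sub_left, Complex.sub_im, hreal, sub_zero, ← inner_conj_symm, Complex.conj_im,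
      abs_neg]
  rw [him, ← ENNReal.toReal_mul, ← hc]
  refine (Complex.abs_im_le_norm _).trans ?_
  refine norm_inner_sum_interaction_le hN j (fun k => proj k φ) Z W ENNReal.toReal_nonneg hΨ
    (fun k x y => inner_proj k φ x y) (fun k l x => proj_comm k l φ x)
    (fun k x => norm_proj_le hφ1 k x) (fun k hk x => ?_) hW2 (fun k hk x => ?_)
    (fun k hk l hl hlk x => ?_) (fun k => ?_)
  · simpa using (hZ k hk).2 x
  · have hkj := Finset.ne_of_mem_erase hk
    refine proj_mul_proj_eq_zero (z := z k) (χ := proj j φ x) (fun x => ?_) ?_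
    · simp only [z, update_self, update_of_ne hkj.symm, sub_mul]
      have h1 : ∫ y, meanField v φ (x j) * ‖φ y‖ ^ 2 = meanField v φ (x j) := by
        rw [integral_const_mul, ← norm_sq_eq_integral, hφ1]
        ring
      rw [integral_sub (integrable_translate_mul hrs hv hv' hφ (x j))
        ((Lp.memLp φ).norm.integrable_sq.const_mul _), h1, ← meanField_eq, sub_self]
    · rw [← proj_comm]
      exact (hZ k hk).1 (proj k φ x)
  · have hlj := Finset.ne_of_mem_erase hl
    apply Lp.ext
    have h1 := ae_proj_mul (l := l) (u := fun x => (z k x : ℂ)) (fun x y => by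
      simp only [z, update_of_ne hlj.symm, update_of_ne hlk.symm]) φ ((hZ k hk).1 x)
    filter_upwards [h1, (hZ k hk).1 (proj l φ x)] with y h1 h2
    rw [h1, h2, proj_comm]
  · have h := norm_coproj_eq_of_isSymmetric hΨs hφ1 k j
    rw [← coproj_apply]
    exact (pow_left_inj₀ (norm_nonneg _) (norm_nonneg _) two_ne_zero).1 h

theorem alpha_le_of_measurable_even {r s : ℝ≥0∞} (hrs : ENNReal.HolderConjugate r s)
    {v : Space → ℝ} (hv : StronglyMeasurable v) (hv' : MemLp v (2 * r) volume)
    (hv_even : ∀ x, v (-x) = v x) {T : ℝ} {A : ℝ → Space → ℝ} (hN : 1 ≤ N)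
    {Ψ : ℝ → ManyBody N} (hΨ : SolvesSchrodinger N v A T Ψ) (hΨ_symm : IsSymmetric (Ψ 0))
    (hΨ_norm : ‖Ψ 0‖ = 1) {φ : ℝ → OneBody} (hφ : SolvesHartree v A T φ) (hφ_norm : ‖φ 0‖ = 1)
    (hφ_mem : ∀ t ∈ Set.Icc 0 T, MemLp (φ t) (2 * s) volume) {α C : ℝ → ℝ}
    (hα : ∀ t, α t = alpha N (fun k => (k : ℝ) / N) (Ψ t) (φ t))
    (hC : ∀ t, C t =
      10 * (eLpNorm v (2 * r) volume).toReal * (eLpNorm (φ t) (2 * s) volume).toReal)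
    (hC_int : IntervalIntegrable C volume 0 T) :
    ∀ t ∈ Set.Icc 0 T, (∀ j : Fin N, α t = ‖coproj j (φ t) (Ψ t)‖ ^ 2) ∧
      α t ≤ Real.exp (∫ τ in (0 : ℝ)..t, C τ) * α 0 +
        (Real.exp (∫ τ in (0 : ℝ)..t, C τ) - 1) * (N : ℝ)⁻¹ := by
  have hΨ1 : ∀ t ∈ Set.Icc 0 T, ‖Ψ t‖ = 1 := fun t ht =>
    (IsSolution.norm_eq (isTestOperator_totalLaplacian N) hΨ t ht).trans hΨ_norm
  -- The Hartree equation is linear in `φ` once its potential is regarded as given.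
  have hφ1 : ∀ t ∈ Set.Icc 0 T, ‖φ t‖ = 1 := fun t ht =>
    (IsSolution.norm_eq isTestOperator_laplacian hφ t ht).trans hφ_norm
  have hsymm := hΨ.isSymmetric hv_even hΨ_symm
  have hαj : ∀ t ∈ Set.Icc 0 T, ∀ j : Fin N, α t = ‖coproj j (φ t) (Ψ t)‖ ^ 2 := fun t ht j => by
    rw [hα, alpha_eq hN (hφ1 t ht) (hsymm t ht) j]
  -- Any particle would do, by symmetry; `1 ≤ N` provides one.
  let j : Fin N := ⟨0, hN⟩
  have hd : ∀ t ∈ Set.Icc 0 T, ∃ a : ℝ, HasDerivWithinAt α a (Set.Icc 0 T) t ∧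
      a ≤ C t * (α t + (N : ℝ)⁻¹) := by
    intro t ht
    obtain ⟨Ψ', hΨd, hΨH⟩ := hΨ t ht
    obtain ⟨φ', hφd, hφH⟩ := hφ t ht
    have hFd := hasDerivWithinAt_inner_exchangeL (hasDerivWithinAt_tensor hΨd hφd) j
    have hH := isHamiltonianValue_tensor hΨH hφH
    rw [smul_tensor, tensor_smul, ← smul_add, add_comm] at hH
    obtain ⟨χ, hχ, hQ, hle⟩ := abs_im_inner_fluctuation_le hN hrs hv hv' hv_even (hφ1 t ht)
      (hφ_mem t ht) (hΨ1 t ht) (hsymm t ht) j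
    have hre := re_inner_exchangeL_eq (exchange_invariant_potential hv_even (A t) (φ t) j) hH hχ hQ
    rw [hre] at hFd
    refine ⟨_, hFd.congr_of_mem (fun u hu => ?_) ht, ?_⟩
    · rw [hαj u hu j, norm_coproj_sq_eq_sub j (hφ1 u hu) (hΨ1 u hu)]
    -- The constant `10` is the `2` from the two conjugate terms of the derivative times the `5` of
    -- the fluctuation estimate.
    · rw [hαj t ht j, hC]
      have := neg_abs_le (inner ℂ χ (Ψ t)).im
      linarith
  intro t ht
  exact ⟨hαj t ht, add_le_mul_exp_of_deriv_le (by positivity)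
    (fun u hu => hαj u hu j ▸ sq_nonneg _) hd hC_int t ht⟩

end MainEstimate

/-! ### Replacing the potential by a measurable, everywhere even representative -/

section Measurability

/-- Integrating the indicator of a null set over `x_j` first already gives `0`, by translation
invariance. Hence changing `v` on a null set changes the pair potentials only on a null set of
configurations. -/
theorem ae_sub {N : ℕ} {j k : Fin N} (hjk : k ≠ j) {P : Space → Prop} (h : ∀ᵐ y, P y) :
    ∀ᵐ x : Config N, P (x j - x k) := by
  obtain ⟨S, hS, hSm, hS0⟩ := exists_measurable_superset_of_null (ae_iff.1 h)
  have hd : Measurable fun x : Config N => x j - x k :=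
    (measurable_pi_apply j).sub (measurable_pi_apply k)
  have hm : Measurable fun x : Config N => S.indicator (1 : Space → ℝ≥0∞) (x j - x k) :=
    (measurable_one.indicator hSm).comp hd
  have key : ∫⁻ x : Config N, S.indicator (1 : Space → ℝ≥0∞) (x j - x k) =
      ∫⁻ _ : Config N, 0 := by
    refine lintegral_eq_of_lmarginal_eq (μ := fun _ : Fin N => (volume : Measure Space)) {j}
      hm measurable_const ?_
    rw [lmarginal_singleton, lmarginal_singleton]
    funext x
    simp only [update_self, update_of_ne hjk]
    rw [lintegral_sub_right_eq_self (fun y => S.indicator (1 : Space → ℝ≥0∞) y),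
      lintegral_indicator_one hSm, hS0, lintegral_zero]
  rw [lintegral_zero] at key
  filter_upwards [(lintegral_eq_zero_iff hm).1 key] with x hx
  by_contra hP
  have : x j - x k ∈ S := hS hP
  simp [this] at hx

theorem manyBodyPotential_congr_ae {N : ℕ} {v u : Space → ℝ} (h : v =ᵐ[volume] u)
    (A : Space → ℝ) : manyBodyPotential N v A =ᵐ[volume] manyBodyPotential N u A := by
  have hall : ∀ᵐ x : Config N, ∀ j, ∀ k ∈ Finset.Ioi j, v (x j - x k) = u (x j - x k) := by
    rw [ae_all_iff]
    intro j
    rw [Finset.eventually_all]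
    exact fun k hk => ae_sub (Finset.mem_Ioi.1 hk).ne' h
  filter_upwards [hall] with x hx
  rw [manyBodyPotential, manyBodyPotential]
  congr 1
  refine Finset.sum_congr rfl fun j _ => Finset.sum_congr rfl fun k hk => ?_
  rw [hx j k hk]

theorem hartreePotential_congr_ae {v u : Space → ℝ} (h : v =ᵐ[volume] u) (A : Space → ℝ)
    (φ : OneBody) : hartreePotential v A φ = hartreePotential u A φ := by
  ext x
  rw [hartreePotential, hartreePotential, convolution, convolution]
  congr 1
  refine integral_congr_ae ?_
  filter_upwards [h] with y hy
  rw [hy]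

theorem IsSolution.congr_ae {X : Type*} [NormedAddCommGroup X] [NormedSpace ℝ X] [MeasureSpace X]
    {lap : (X → ℂ) → X → ℂ} {V U : ℝ → X → ℝ} {T : ℝ} {f : ℝ → Lp ℂ 2 (volume : Measure X)}
    (hf : IsSolution lap V T f) (h : ∀ t, V t =ᵐ[volume] U t) : IsSolution lap U T f := by
  intro t ht
  obtain ⟨f', h1, g, w, h2, h3, h4⟩ := hf t ht
  refine ⟨f', h1, g, w, h2, ?_, h4⟩
  filter_upwards [h3, h t] with x hx hx'
  rw [hx, hx']

theorem exists_stronglyMeasurable_even {v : Space → ℝ} (hv : AEStronglyMeasurable v volume)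
    (hv_even : ∀ᵐ x, v (-x) = v x) :
    ∃ u : Space → ℝ, StronglyMeasurable u ∧ (∀ x, u (-x) = u x) ∧ v =ᵐ[volume] u := by
  -- Averaging a measurable representative with its reflection enforces evenness at every point, and
  -- changes nothing almost everywhere because `v` is almost everywhere even.
  refine ⟨fun x => 2⁻¹ * (hv.mk v x + hv.mk v (-x)),
    (hv.stronglyMeasurable_mk.add (hv.stronglyMeasurable_mk.comp_measurable
      measurable_neg)).const_mul _, fun x => by simp only [neg_neg, add_comm], ?_⟩
  have hneg := (Measure.measurePreserving_neg (volume : Measure Space)).quasiMeasurePreserving.ae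
    hv.ae_eq_mk
  filter_upwards [hv.ae_eq_mk, hneg, hv_even] with x h1 h2 h3
  rw [← h1, ← h2, h3]
  ring

end Measurability

end MeanField

end

theorem theorem1
    (r s : ℝ≥0∞) (hr : 1 ≤ r) (hrs : ENNReal.HolderConjugate r s)
    (v : MeanField.Space → ℝ) (hv : MemLp v (2 * r) volume) (hv_even : ∀ᵐ x, v (-x) = v x)
    (T : ℝ) (A : ℝ → MeanField.Space → ℝ) (hA : ∀ t ∈ Set.Icc 0 T, AEMeasurable (A t) volume)
    (N : ℕ) (hN : 1 ≤ N)
    (Ψ : ℝ → MeanField.ManyBody N) (hΨ : MeanField.SolvesSchrodinger N v A T Ψ)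
    (hΨ_symm : MeanField.IsSymmetric (Ψ 0)) (hΨ_norm : ‖Ψ 0‖ = 1)
    (φ : ℝ → MeanField.OneBody) (hφ : MeanField.SolvesHartree v A T φ) (hφ_norm : ‖φ 0‖ = 1)
    (hφ_mem : ∀ t ∈ Set.Icc 0 T, MemLp (φ t) (2 * s) volume)
    (α : ℝ → ℝ) (hα : ∀ t, α t = MeanField.alpha N (fun k => (k : ℝ) / N) (Ψ t) (φ t))
    (C : ℝ → ℝ)
    (hC : ∀ t, C t =
      10 * (eLpNorm v (2 * r) volume).toReal * (eLpNorm (φ t) (2 * s) volume).toReal)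
    (hC_int : IntervalIntegrable C volume 0 T) :
    ∀ t ∈ Set.Icc 0 T,
      (∀ j : Fin N, α t = ‖MeanField.coproj j (φ t) (Ψ t)‖ ^ 2) ∧
      α t ≤ Real.exp (∫ τ in (0 : ℝ)..t, C τ) * α 0 +
        (Real.exp (∫ τ in (0 : ℝ)..t, C τ) - 1) * (N : ℝ)⁻¹ := by
  -- The equations and the norm of the potential depend on `v` only up to null sets, so `v` may be
  -- exchanged for a representative with pointwise symmetry.
  obtain ⟨u, hu, hu_even, hvu⟩ :=
    MeanField.exists_stronglyMeasurable_even hv.aestronglyMeasurable hv_even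
  have hΨ' : MeanField.SolvesSchrodinger N u A T Ψ :=
    MeanField.IsSolution.congr_ae hΨ fun t => MeanField.manyBodyPotential_congr_ae hvu (A t)
  have hφ' : MeanField.SolvesHartree u A T φ := by
    refine MeanField.IsSolution.congr_ae hφ fun t => ?_
    rw [MeanField.hartreePotential_congr_ae hvu]
  have hC' : ∀ t, C t =
      10 * (eLpNorm u (2 * r) volume).toReal * (eLpNorm (φ t) (2 * s) volume).toReal := fun t => by
    rw [hC, eLpNorm_congr_ae hvu]
  exact MeanField.alpha_le_of_measurable_even hrs hu (hv.ae_eq hvu) hu_even hN hΨ' hΨ_symm hΨ_norm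
    hφ' hφ_norm hφ_mem hα hC' hC_int
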